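/- **Setting.** QPT means a polynomial-time uniform family of quantum circuits. A symmetric-key quantum encryption scheme (SKQES) $\Pi$ has uniformly random classical keys $k$, QPT channels $\mathsf{Enc}_k: \mathfrak D(\mathcal H_M)\to\mathfrak D(\mathcal H_C)$ and $\mathsf{Dec}_k:\mathfrak D(\mathcal H_C)\to\mathfrak D(\mathcal H_M\oplus|\bot\rangle\langle\bot|)$, and satisfies $\|\mathsf{Dec}_k\circ\mathsf{Enc}_k-\mathrm{id}_M\oplus 0_\bot\|_\diamond\le\mathrm{negl}(n)$ for every $k$; the lengths of keys, plaintexts and ciphertexts (in qubits) are functions of the security parameter $n$ computable in time polynomial in $n$ (length zero is allowed). A *characterization* of $\Pi$ consists, for each $k$, of a unitary $V_k:\mathcal H_M\otimes\mathcal H_T\to\mathcal H_C$, a probability distribution $p_k$, an orthonormal basis $|\psi^{(k,r)}\rangle$ of $\mathcal H_T$ and a channel $\hat D_k$ such that, with $\Pi_{k,r}=|\psi^{(k,r)}\rangle\langle\psi^{(k,r)}|$, $\sigma_k=\sum_r p_k(r)\,\Pi_{k,r}$, $P$ the projector onto the support of $\sigma_k$ and $\bar P=1-P$ (both acting on $T$),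 $$\mathsf{Enc}_k(X)=V_k(X\otimes\sigma_k)V_k^\dagger,\qquad \mathsf{Dec}_k(Y)=\mathrm{Tr}_T\big[P\,V_k^\dagger YV_k\,P\big]+\hat D_k\big[\bar P\,V_k^\dagger YV_k\,\bar P\big].$$ Below, "replacing" an encryption query means: prepare a maximally entangled pair $\phi^+_{M'M''}$, sample $r\leftarrow p_k$, answer with $V_k(M'\otimes|\psi^{(k,r)}\rangle\langle\psi^{(k,r)}|)V_k^\dagger$, and keep $(r,M'')$. A ciphertext "matches" a kept pair $(r,M'')$ if, after applying $V_k^\dagger$, measuring $\{\Pi_{k,r},1-\Pi_{k,r}\}$ on $T$ and then $\{\Pi^+,1-\Pi^+\}$ on $MM''$ (with $\Pi^+$ the projector onto $\phi^+$) gives the first outcome both times. Each of the following notions refers to a characterization of $\Pi$. * **QUF**: for every QPT $\mathcal A$, $|\Pr[\text{Forge}\to\text{win}]-\Pr[\text{Cheat}\to\text{cheat}]|\le\mathrm{negl}(n)$. In Forge, $\mathcal A^{\mathsf{Enc}_k}$ wins if its output ciphertext does not decrypt to $\bot$. In Cheat, the plaintexts of all encryption queries are discarded and the queries are replaced; the outcome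 is cheat if the output of $\mathcal A$ matches one of the kept pairs, tested one after the other. * **QIND-CCA2**: for every QPT $\mathcal A=(\mathcal A_1,\mathcal A_2)$, $\Pr[\text{Test}\to\text{win}]-\Pr[\text{Fake}\to\text{cheat}]\le\mathrm{negl}(n)$. In Test, $\mathcal A_1^{\mathsf{Enc}_k,\mathsf{Dec}_k}$ outputs a challenge plaintext and a side register; $\mathcal A_2^{\mathsf{Enc}_k,\mathsf{Dec}_k}$ gets the side register and an encryption of the challenge ($b=0$) or of the maximally mixed state ($b=1$), $b$ uniform, and wins if it outputs $b$. In Fake, the challenge is discarded and replaced, and the decryption oracle of $\mathcal A_2$ first measures $\{P,\bar P\}$ on the tag: on outcome $\bar P$ it applies $\hat D_k$; otherwise it tests whether the query matches the challenge, in which case the game stops with outcome cheat, and if not it returns the plaintext register. If the game has not stopped, the outcome is cheat with probability $1/2$. * **QAE**: for every QPT $\mathcal A$, $|\Pr[\text{Real}\to\text{real}]-\Pr[\text{Ideal}\to\text{real}]|\le\mathrm{negl}(n)$. In Real, $\mathcal A$ has oracles $\mathsf{Enc}_k,\mathsf{Dec}_k$. In Ideal, every encryption query is replaced and its plaintext is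 stored with the kept pair; a decryption query is tested against the kept pairs in order; the plaintext stored with the first match is returned, and $\bot$ if there is no match. For an SKQES $\Pi$ let $\Pi^0$ be the scheme with the same keys, lengths and encryption, in which decryption outputs the plaintext $|0\cdots0\rangle\langle0\cdots0|$ instead of $\bot$; a characterization of $\Pi$ is carried to $\Pi^0$ by keeping $V_k,p_k,\psi^{(k,r)}$ and replacing $\bot$ by $|0\cdots0\rangle\langle 0\cdots0|$ in the output of $\hat D_k$. **Proposition.** QIND-CCA2 does not imply QUF, and does not imply QAE. More precisely: 1. Let $\Pi$ be any SKQES that is QIND-CCA2 with respect to a characterization. Then $\Pi^0$ is an SKQES, the carried-over data characterize $\Pi^0$, and $\Pi^0$ is QIND-CCA2 with respect to them; but $\Pi^0$ is neither QUF nor QAE, with respect to any characterization. 2. There is an SKQES that is QIND-CCA2 with respect to some characterization, but is neither QUF nor QAE with respect to any characterization. -/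

import Mathlib

open scoped Matrix Kronecker ComplexOrder

noncomputable section

namespace QEnc

/-! ### Registers, operators, channels -/

/-- Computational basis labels of a register of `k` qubits. -/
abbrev Bits (k : ℕ) := Fin k → Bool

/-- Operators on the Hilbert space with orthonormal basis `α`. -/
abbrev Op (α : Type) := Matrix α α ℂ

abbrev SuperOp (α β : Type) := Op α → Op β

/-- The all-zero string. -/
def zeros {k : ℕ} : Bits k := fun _ => false

/-- `Φ` is a quantum channel (completely positive and trace preserving), in operator-sum form. -/
def IsChannel {α β : Type} [Fintype α] [DecidableEq α] [Fintype β] (Φ : SuperOp α β) : Prop :=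
  ∃ (s : ℕ) (K : Fin s → Matrix β α ℂ),
    (∀ X, Φ X = ∑ i, K i * X * (K i)ᴴ) ∧ ∑ i, (K i)ᴴ * K i = 1

/-- `Φ ⊗ id` on a composite system. -/
def ampl {α β : Type} (E : Type) (Φ : SuperOp α β) : SuperOp (α × E) (β × E) :=
  fun X => Matrix.of fun p q => Φ (Matrix.of fun a b => X (a, p.2) (b, q.2)) p.1 q.1

def IsDensity {α : Type} [Fintype α] (ρ : Op α) : Prop := ρ.PosSemidef ∧ ρ.trace = 1

/-- The trace norm: the sum of the singular values. -/
def traceNorm {α : Type} [Fintype α] [DecidableEq α] (A : Op α) : ℝ :=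
  ∑ i, Real.sqrt ((Matrix.isHermitian_conjTranspose_mul_self A).eigenvalues i)

/-- `‖Φ - Ψ‖_⋄ ≤ ε`: the trace distance is at most `ε` on every state of the input register
together with an arbitrary finite-dimensional reference system. -/
def DiamondLE {α β : Type} [Fintype α] [Fintype β] [DecidableEq β]
    (Φ Ψ : SuperOp α β) (ε : ℝ) : Prop :=
  ∀ (d : ℕ) (ρ : Op (α × Fin d)), IsDensity ρ →
    traceNorm (ampl (Fin d) Φ ρ - ampl (Fin d) Ψ ρ) ≤ ε

/-- The embedding `X ↦ X ⊕ 0_⊥` of plaintext operators; the basis of `H_M ⊕ ⊥` is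
`Option (Bits m)`, with `none` for the reject symbol. -/
def embed {m : ℕ} : SuperOp (Bits m) (Option (Bits m)) :=
  fun X => Matrix.of fun o o2 =>
    match o, o2 with
    | some x, some y => X x y
    | _, _ => 0

/-- The channel on `H_M ⊕ ⊥` that replaces the reject symbol by the all-zero plaintext state and
leaves plaintexts unchanged. -/
def rejectToZero {m : ℕ} : SuperOp (Option (Bits m)) (Option (Bits m)) :=
  fun X => Matrix.of fun o o2 =>
    match o, o2 with
    | some x, some y =>
        X (some x) (some y) + (if x = zeros ∧ y = zeros then X none none else 0)
    | _, _ => 0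

/-- `ε` vanishes faster than every inverse polynomial. -/
def Negligible (ε : ℕ → ℝ) : Prop := Asymptotics.SuperpolynomialDecay Filter.atTop (fun n : ℕ => (n : ℝ)) ε

/-! ### Quantum circuits

A circuit acts on five named registers: a key register `K` (empty for adversaries), a plaintext
register `M`, a one-qubit reject flag `F`, a ciphertext register `C` and a workspace `W`. -/

inductive Reg
  | K | M | F | C | W
  deriving DecidableEq

instance : Fintype Reg where
  elems := {Reg.K, Reg.M, Reg.F, Reg.C, Reg.W}
  complete := by intro r; cases r <;> simp

/-- Circuit instructions: Hadamard, `diag(1, e^{iπ/4})`, CNOT (control, then target), resetting a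
qubit to `|0⟩`, and calling one of the oracles in `Ω`. Qubits are addressed by a register and a
position in it. -/
inductive Instr (Ω ι : Type)
  | hadamard (r : Reg) (i : ι)
  | phaseT (r : Reg) (i : ι)
  | cnot (r : Reg) (i : ι) (r2 : Reg) (i2 : ι)
  | reset (r : Reg) (i : ι)
  | query (o : Ω)

def Instr.reindex {Ω ι κ : Type} (f : ι → κ) : Instr Ω ι → Instr Ω κ
  | .hadamard r i => .hadamard r (f i)
  | .phaseT r i => .phaseT r (f i)
  | .cnot r i r2 i2 => .cnot r (f i) r2 (f i2)
  | .reset r i => .reset r (f i)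
  | .query o => .query o

def wPos (r : Reg) (i : ℕ) : ℕ := if r = Reg.W then i else 0

/-- The largest workspace position that an instruction addresses. -/
def Instr.maxW {Ω : Type} : Instr Ω ℕ → ℕ
  | .hadamard r i => wPos r i
  | .phaseT r i => wPos r i
  | .cnot r i r2 i2 => max (wPos r i) (wPos r2 i2)
  | .reset r i => wPos r i
  | .query _ => 0

/-- The workspace of a circuit `l` consists of the `width l + 1` qubits `0, …, width l`. -/
def width {Ω : Type} (l : List (Instr Ω ℕ)) : ℕ := (l.map Instr.maxW).foldr max 0

/-! ### Uniform generation in polynomial time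

A deterministic multi-stack machine over the alphabet `Bool` (two stacks already simulate a tape)
that writes a circuit to a write-only output, one instruction after the other. In each step it
reads the tops of its stacks, pops, pushes or keeps each of them, writes a fixed finite list of
instructions, and changes its state or halts. The position of a qubit in an instruction is written
in unary: it is the current height of a stack. -/

inductive StackOp
  | keep
  | push (b : Bool)
  | pop

def StackOp.act : StackOp → List Bool → List Bool
  | .keep, l => l
  | .push b, l => b :: l
  | .pop, l => l.tail

structure Machine (Ω : Type) where
  states : ℕ
  start : Fin states
  numStacks : ℕ
  step : Fin states → (Fin (numStacks + 1) → Option Bool) →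
    Option (Fin states) × (Fin (numStacks + 1) → StackOp) × List (Instr Ω (Fin (numStacks + 1)))

/-- A configuration; `state = none` means that the machine has halted. -/
structure Config {Ω : Type} (A : Machine Ω) where
  state : Option (Fin A.states)
  stack : Fin (A.numStacks + 1) → List Bool
  out : List (Instr Ω ℕ)

/-- Input `1^n` on stack `0`, all other stacks empty. -/
def Machine.init {Ω : Type} (A : Machine Ω) (n : ℕ) : Config A where
  state := some A.start
  stack := fun i => if i = 0 then List.replicate n true else []
  out := []

def Machine.next {Ω : Type} (A : Machine Ω) (c : Config A) : Config A :=
  match c.state with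
  | none => c
  | some q =>
    let d := A.step q (fun i => (c.stack i).head?)
    { state := d.1
      stack := fun i => (d.2.1 i).act (c.stack i)
      out := c.out ++ d.2.2.map (Instr.reindex fun i => (c.stack i).length) }

/-- A QPT algorithm with oracles `Ω`: a uniform family of quantum circuits, generated on input
`1^n` by a machine that halts within polynomially many steps. -/
structure QPT (Ω : Type) where
  machine : Machine Ω
  bound : Polynomial ℕ
  halts : ∀ n : ℕ, ((machine.next)^[bound.eval n] (machine.init n)).state = none

/-- The circuit for security parameter `n`. -/
def QPT.circuit {Ω : Type} (A : QPT Ω) (n : ℕ) : List (Instr Ω ℕ) :=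
  ((A.machine.next)^[A.bound.eval n] (A.machine.init n)).out

/-- `f` is computable in time polynomial in `n`, with input and output in unary. -/
def PolyTimeLength (f : ℕ → ℕ) : Prop :=
  ∃ A : QPT Empty, ∀ n, (A.circuit n).length = f n

/-! ### Semantics of circuits -/

/-- Register sizes; the workspace has `w + 1` qubits. -/
abbrev layout (κ m c w : ℕ) : Reg → ℕ
  | .K => κ
  | .M => m
  | .F => 1
  | .C => c
  | .W => w + 1

/-- Basis labels of all registers together. -/
abbrev Basis (κ m c w : ℕ) := ∀ r : Reg, Bits (layout κ m c w r)

/-- Joint (possibly subnormalized) states of a circuit's registers and a further system `E`. -/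
abbrev State (κ m c w : ℕ) (E : Type) := Op (Basis κ m c w × E)

section circuits

variable {κ m c w : ℕ} {E : Type} [Fintype E] [DecidableEq E]

def setReg (x : Basis κ m c w) (r : Reg) (a : Bits (layout κ m c w r)) : Basis κ m c w :=
  Function.update x r a

def setWire (x : Basis κ m c w) (r : Reg) (i : Fin (layout κ m c w r)) (b : Bool) :
    Basis κ m c w :=
  setReg x r (Function.update (x r) i b)

/-- The one-qubit operator `G` on one qubit, identity on all others. -/
def wireOp (r : Reg) (i : Fin (layout κ m c w r)) (G : Matrix Bool Bool ℂ) :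
    Op (Basis κ m c w) :=
  Matrix.of fun x y => if y = setWire x r i (y r i) then G (x r i) (y r i) else 0

def cnotOp (r : Reg) (i : Fin (layout κ m c w r)) (r2 : Reg) (i2 : Fin (layout κ m c w r2)) :
    Op (Basis κ m c w) :=
  Matrix.of fun x y => if x = setWire y r2 i2 (xor (y r2 i2) (y r i)) then 1 else 0

def hadamardGate : Matrix Bool Bool ℂ :=
  Matrix.of fun a b => (if a && b then -1 else 1) / (Real.sqrt 2 : ℂ)

def phaseGate : Matrix Bool Bool ℂ :=
  Matrix.of fun a b =>
    if a = b then (if a then Complex.exp (Complex.I * Real.pi / 4) else 1) else 0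

/-- `ρ ↦ (A ⊗ 1) ρ (A ⊗ 1)ᴴ`. -/
def conjBy (A : Op (Basis κ m c w)) (ρ : State κ m c w E) : State κ m c w E :=
  (A ⊗ₖ (1 : Op E)) * ρ * (A ⊗ₖ (1 : Op E))ᴴ

/-- Discard one qubit and replace it by `|0⟩`. -/
def resetWire (r : Reg) (i : Fin (layout κ m c w r)) (ρ : State κ m c w E) : State κ m c w E :=
  Matrix.of fun p q =>
    if p.1 r i = false ∧ q.1 r i = false then
      ∑ b : Bool, ρ (setWire p.1 r i b, p.2) (setWire q.1 r i b, q.2)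
    else 0

/-- The action of an instruction other than an oracle call. Instructions that address a
nonexistent qubit, and CNOTs whose control is their target, do nothing. -/
def applyGate {Ω : Type} : Instr Ω ℕ → State κ m c w E → State κ m c w E
  | .hadamard r i, ρ =>
      if h : i < layout κ m c w r then conjBy (wireOp r ⟨i, h⟩ hadamardGate) ρ else ρ
  | .phaseT r i, ρ =>
      if h : i < layout κ m c w r then conjBy (wireOp r ⟨i, h⟩ phaseGate) ρ else ρ
  | .cnot r i r2 i2, ρ =>
      if h : i < layout κ m c w r ∧ i2 < layout κ m c w r2 ∧ ¬(r = r2 ∧ i = i2) then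
        conjBy (cnotOp r ⟨i, h.1⟩ r2 ⟨i2, h.2.1⟩) ρ
      else ρ
  | .reset r i, ρ =>
      if h : i < layout κ m c w r then resetWire r ⟨i, h⟩ ρ else ρ
  | .query _, ρ => ρ

/-- Encoding of `H_M ⊕ ⊥` in the registers `M` and `F`: a plaintext has flag `0`, and `⊥` is flag
`1` with `M` in the all-zero state. `none` for strings that are not in use. -/
def unflag (μ : Bits m) (f : Bits 1) : Option (Option (Bits m)) :=
  if f 0 = false then some (some μ) else if μ = zeros then some none else none

/-- A call to an encryption oracle. The register `M` is handed over, and the response replaces the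
contents of `C`; `M` is left in the all-zero state. The oracle acts jointly on the query
and on the memory of the challenger. -/
def encCall {E2 : Type} (Ψ : SuperOp (Bits m × E) (Bits c × E2)) (ρ : State κ m c w E) :
    State κ m c w E2 :=
  Matrix.of fun p q =>
    if p.1 .M = zeros ∧ q.1 .M = zeros then
      Ψ (Matrix.of fun a b => ∑ u : Bits c,
          ρ (setReg (setReg p.1 .M a.1) .C u, a.2) (setReg (setReg q.1 .M b.1) .C u, b.2))
        (p.1 .C, p.2) (q.1 .C, q.2)
    else 0

/-- A call to a decryption oracle. The register `C` is handed over (and left in the all-zero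
state), and the response, after the measurement whether it is `⊥`, replaces the contents of `M`
and `F`. -/
def decCall {E2 : Type} (Ψ : SuperOp (Bits c × E) (Option (Bits m) × E2))
    (ρ : State κ m c w E) : State κ m c w E2 :=
  Matrix.of fun p q =>
    if p.1 .C = zeros ∧ q.1 .C = zeros ∧ p.1 .F = q.1 .F then
      match unflag (p.1 .M) (p.1 .F), unflag (q.1 .M) (q.1 .F) with
      | some o, some o2 =>
          Ψ (Matrix.of fun a b => ∑ u : Bits m, ∑ f : Bits 1,
              ρ (setReg (setReg (setReg p.1 .M u) .F f) .C a.1, a.2)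
                (setReg (setReg (setReg q.1 .M u) .F f) .C b.1, b.2))
            (o, p.2) (o2, q.2)
      | _, _ => 0
    else 0

/-- All qubits in state `|0⟩`, the memory in the given basis state. -/
def startState (e : E) : State κ m c w E :=
  Matrix.of fun p q =>
    if p = ((fun _ => zeros), e) ∧ q = ((fun _ => zeros), e) then 1 else 0

/-- The reduced state of the register `C` and the memory. -/
def reduceC (ρ : State κ m c w E) : Op (Bits c × E) :=
  Matrix.of fun p q => ∑ x : Basis κ m c w,
    if x .C = p.1 then ρ (x, p.2) (setReg x .C q.1, q.2) else 0

/-- The reduced state of the registers `M` and `F`. -/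
def reduceMF (ρ : State κ m c w Unit) : Op (Bits m × Bits 1) :=
  Matrix.of fun p q => ∑ x : Basis κ m c w,
    if x .M = p.1 ∧ x .F = p.2 then ρ (x, ()) (setReg (setReg x .M q.1) .F q.2, ()) else 0

/-- The probability that measuring the first workspace qubit gives `b`. -/
def outProb (b : Bool) (ρ : State κ m c w E) : ℝ :=
  ∑ x : Basis κ m c w, ∑ e : E, if (x .W : Bits (w + 1)) 0 = b then (ρ (x, e) (x, e)).re else 0

end circuits

/-! ### Symmetric-key quantum encryption schemes -/

/-- Key, plaintext and ciphertext lengths (in qubits, as functions of the security parameter), and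
the encryption and decryption maps. Keys are uniformly random. -/
structure Scheme where
  keyLen : ℕ → ℕ
  ptLen : ℕ → ℕ
  ctLen : ℕ → ℕ
  Enc : ∀ n, Bits (keyLen n) → SuperOp (Bits (ptLen n)) (Bits (ctLen n))
  Dec : ∀ n, Bits (keyLen n) → SuperOp (Bits (ctLen n)) (Option (Bits (ptLen n)))

/-- Key register `|k⟩`, register `r` in state `X`, all other qubits `|0⟩`. -/
def loadState {κ m c : ℕ} (w : ℕ) (k : Bits κ) (r : Reg) (X : Op (Bits (layout κ m c w r))) :
    State κ m c w Unit :=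
  Matrix.of fun p q =>
    let base : Basis κ m c w := setReg (fun _ => zeros) .K k
    if p.1 = setReg base r (p.1 r) ∧ q.1 = setReg base r (q.1 r) then X (p.1 r) (q.1 r) else 0

/-- The circuit `l` computes the encryption map `Φ` under the key `k`. -/
def ComputesEnc {κ m c : ℕ} (l : List (Instr Empty ℕ)) (k : Bits κ)
    (Φ : SuperOp (Bits m) (Bits c)) : Prop :=
  ∀ X : Op (Bits m),
    reduceC (l.foldl (fun ρ g => applyGate g ρ) (loadState (c := c) (width l) k .M X)) =
      Matrix.of fun p q => Φ X p.1 q.1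

/-- The circuit `l` computes the decryption map `Φ` under the key `k`. -/
def ComputesDec {κ m c : ℕ} (l : List (Instr Empty ℕ)) (k : Bits κ)
    (Φ : SuperOp (Bits c) (Option (Bits m))) : Prop :=
  ∀ Y : Op (Bits c),
    reduceMF (l.foldl (fun ρ g => applyGate g ρ) (loadState (m := m) (width l) k .C Y)) =
      Matrix.of fun p q =>
        match unflag p.1 p.2, unflag q.1 q.2 with
        | some o, some o2 => Φ Y o o2
        | _, _ => 0

/-- `S` is a symmetric-key quantum encryption scheme: lengths, encryption and decryption are
efficiently computable, and decryption inverts encryption up to a negligible error. -/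
structure IsSKQES (S : Scheme) : Prop where
  keyLen_poly : PolyTimeLength S.keyLen
  ptLen_poly : PolyTimeLength S.ptLen
  ctLen_poly : PolyTimeLength S.ctLen
  enc_channel : ∀ n k, IsChannel (S.Enc n k)
  dec_channel : ∀ n k, IsChannel (S.Dec n k)
  enc_qpt : ∃ A : QPT Empty, ∀ n k, ComputesEnc (A.circuit n) k (S.Enc n k)
  dec_qpt : ∃ A : QPT Empty, ∀ n k, ComputesDec (A.circuit n) k (S.Dec n k)
  correct : ∃ ε, Negligible ε ∧
    ∀ n k, DiamondLE (fun X => S.Dec n k (S.Enc n k X)) embed (ε n)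

/-- The scheme in which decryption outputs the all-zero plaintext instead of `⊥`. -/
def Scheme.neverReject (S : Scheme) : Scheme where
  keyLen := S.keyLen
  ptLen := S.ptLen
  ctLen := S.ctLen
  Enc := S.Enc
  Dec := fun n k Y => rejectToZero (S.Dec n k Y)

/-! ### The characterization of encryption schemes

For a fixed key: encryption samples `r` from `p`, attaches the tag state `ψ r` and applies the
unitary `V`; decryption undoes `V`, checks the support of `σ = ∑ r, p r |ψ r⟩⟨ψ r|`, and applies
`Dhat` if the check fails. -/

structure Decomp (m t c : ℕ) where
  V : Matrix (Bits c) (Bits m × Bits t) ℂ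
  p : Bits t → ℝ
  ψ : Bits t → Bits t → ℂ
  Dhat : SuperOp (Bits m × Bits t) (Option (Bits m))

namespace Decomp

variable {m t c : ℕ} (D : Decomp m t c)

/-- `|ψ r⟩⟨ψ r|`. -/
def tagPure (r : Bits t) : Op (Bits t) := Matrix.vecMulVec (D.ψ r) (star (D.ψ r))

def σ : Op (Bits t) := ∑ r, (D.p r : ℂ) • D.tagPure r

/-- The projector onto the support of `σ` (the `ψ r` are orthonormal). -/
def supp : Op (Bits t) := ∑ r, if D.p r = 0 then 0 else D.tagPure r

/-- `Vᴴ Y V`. -/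
def undo (Y : Op (Bits c)) : Op (Bits m × Bits t) := D.Vᴴ * Y * D.V

/-- Partial trace over the tag register. -/
def traceTag (X : Op (Bits m × Bits t)) : Op (Bits m) :=
  Matrix.of fun x y => ∑ s, X (x, s) (y, s)

/-- The operator `1 ⊗ B` on plaintext and tag. -/
def onTag (B : Op (Bits t)) : Op (Bits m × Bits t) := (1 : Op (Bits m)) ⊗ₖ B

/-- `D` characterizes the pair `(Enc, Dec)`. -/
structure Characterizes (Enc : SuperOp (Bits m) (Bits c))
    (Dec : SuperOp (Bits c) (Option (Bits m))) : Prop where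
  isometry : D.Vᴴ * D.V = 1
  coisometry : D.V * D.Vᴴ = 1
  p_nonneg : ∀ r, 0 ≤ D.p r
  p_sum : ∑ r, D.p r = 1
  orthonormal : ∀ r s, star (D.ψ r) ⬝ᵥ D.ψ s = if r = s then 1 else 0
  channel : IsChannel D.Dhat
  enc_eq : ∀ X, Enc X = D.V * (X ⊗ₖ D.σ) * D.Vᴴ
  dec_eq : ∀ Y, Dec Y =
    embed (traceTag (onTag D.supp * D.undo Y * onTag D.supp)) +
      D.Dhat (onTag (1 - D.supp) * D.undo Y * onTag (1 - D.supp))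

end Decomp

/-! ### The memory of the challenger

After `j` replaced encryption queries there are `j` slots. Each holds the tag randomness `r` (a
classical register, that is, always block diagonal), the retained half of the maximally entangled
state, and a stored plaintext register, which is left in the all-zero state when its contents are
handed over. -/

abbrev Mem (m t j : ℕ) := Fin j → Bits t × Bits m × Bits m

instance (m t j : ℕ) : DecidableEq (Mem m t j) :=
  Fintype.decidablePiFintype

/-- The maximally entangled state of two plaintext registers. -/
def phiPlus {m : ℕ} (x y : Bits m) : ℂ := if x = y then 1 / (Real.sqrt (2 ^ m) : ℂ) else 0

/-- Discard the plaintext and put the all-zero state in its place. -/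
def discardInput {m : ℕ} (E : Type) : SuperOp (Bits m × E) (Bits m × E) :=
  fun X => Matrix.of fun p q =>
    if p.1 = zeros ∧ q.1 = zeros then ∑ a : Bits m, X (a, p.2) (a, q.2) else 0

namespace Decomp

variable {m t c : ℕ} (D : Decomp m t c)

/-- `(V ⊗ 1)(|φ⁺⟩ ⊗ |ψ r⟩)`: the encryption, with randomness `r`, of one half of the maximally
entangled state, jointly with the other half. -/
def ket (r : Bits t) (γ : Bits c) (μ : Bits m) : ℂ :=
  ∑ x : Bits m, ∑ s : Bits t, D.V γ (x, s) * (phiPlus x μ * D.ψ r s)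

/-- Answer an encryption query with an encryption of half of a fresh maximally entangled state,
and store the randomness, the other half and the query in a new slot. -/
def replaceEnc (j : ℕ) : SuperOp (Bits m × Mem m t j) (Bits c × Mem m t (j + 1)) :=
  fun X => Matrix.of fun p q =>
    match p.2 (Fin.last j), q.2 (Fin.last j) with
    | (r, μ, x), (r2, ν, y) =>
        if r = r2 then
          (D.p r : ℂ) * D.ket r p.1 μ * star (D.ket r q.1 ν) *
            X (x, Fin.init p.2) (y, Fin.init q.2)
        else 0

/-- The projector `Π_{k,r}` on the tag of the ciphertext, for the randomness `r` in slot `i`. -/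
def tagProj {j : ℕ} (i : Fin j) : Op (Bits c × Mem m t j) :=
  Matrix.of fun p q =>
    if p.2 = q.2 then
      (D.V * onTag (m := m) (D.tagPure (p.2 i).1) * D.Vᴴ) p.1 q.1
    else 0

/-- The projector `Π_{k,r} ⊗ Π⁺`, with `r` and the retained half from slot `i`. -/
def matchProj {j : ℕ} (i : Fin j) : Op (Bits c × Mem m t j) :=
  Matrix.of fun p q =>
    match p.2 i, q.2 i with
    | (r, μ, x), (r2, ν, y) =>
        if r = r2 ∧ x = y ∧ ∀ l, l ≠ i → p.2 l = q.2 l then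
          D.ket r p.1 μ * star (D.ket r q.1 ν)
        else 0

/-- No match with slot `i`: the tag measurement gives outcome `1`, or it gives `0` and then the
measurement of `Π⁺` gives outcome `1`. -/
def miss {j : ℕ} (i : Fin j) (X : Op (Bits c × Mem m t j)) : Op (Bits c × Mem m t j) :=
  (1 - D.tagProj i) * X * (1 - D.tagProj i) +
    (D.tagProj i - D.matchProj i) * X * (D.tagProj i - D.matchProj i)

def matchProb {j : ℕ} (i : Fin j) (X : Op (Bits c × Mem m t j)) : ℝ :=
  (D.matchProj i * X * D.matchProj i).trace.re

/-- Test the slots in order; the probability that one of them matches. -/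
def cheatProb {j : ℕ} (X : Op (Bits c × Mem m t j)) : ℝ :=
  ((List.finRange j).foldl (fun s i => (s.1 + D.matchProb i s.2, D.miss i s.2))
    ((0 : ℝ), X)).1

/-- Replace the stored plaintext in slot `i`. -/
def setStored {j : ℕ} (e : Mem m t j) (i : Fin j) (x : Bits m) : Mem m t j :=
  Function.update e i ((e i).1, (e i).2.1, x)

/-- Match with slot `i`: the plaintext stored there is returned. -/
def returnSlot {j : ℕ} (i : Fin j) (X : Op (Bits c × Mem m t j)) :
    Op (Option (Bits m) × Mem m t j) :=
  let Z := D.matchProj i * X * D.matchProj i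
  Matrix.of fun p q =>
    match p.1, q.1 with
    | some x, some y =>
        if (p.2 i).2.2 = zeros ∧ (q.2 i).2.2 = zeros then
          ∑ γ : Bits c, Z (γ, setStored p.2 i x) (γ, setStored q.2 i y)
        else 0
    | _, _ => 0

/-- The ideal decryption oracle: test the slots in order, return the stored plaintext of the first
match, and return `⊥` if there is none. -/
def idealDec (j : ℕ) : SuperOp (Bits c × Mem m t j) (Option (Bits m) × Mem m t j) :=
  fun X =>
    let s := (List.finRange j).foldl
      (fun s i => (s.1 + D.returnSlot i s.2, D.miss i s.2))
      ((0 : Op (Option (Bits m) × Mem m t j)), X)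
    s.1 + Matrix.of fun p q =>
      if p.1 = none ∧ q.1 = none then ∑ γ : Bits c, s.2 (γ, p.2) (γ, q.2) else 0

/-- `V (1 ⊗ B) Vᴴ` on the ciphertext, identity on the memory. -/
def onCt {j : ℕ} (B : Op (Bits t)) : Op (Bits c × Mem m t j) :=
  (D.V * onTag (m := m) B * D.Vᴴ) ⊗ₖ 1

/-- The cheat-detecting decryption oracle, in case it does not detect cheating: the support of the
tag state is tested; if the test succeeds and slot `0` does not match, the plaintext is
returned; if the test fails, `Dhat` is applied. -/
def watchDec : SuperOp (Bits c × Mem m t 1) (Option (Bits m) × Mem m t 1) :=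
  fun X =>
    ampl _ (fun Y => embed (traceTag (D.undo Y))) (D.miss 0 (D.onCt D.supp * X * D.onCt D.supp)) +
      ampl _ (fun Y => D.Dhat (D.undo Y))
        (D.onCt (1 - D.supp) * X * D.onCt (1 - D.supp))

/-- The probability that the cheat-detecting decryption oracle detects cheating. -/
def detectProb (X : Op (Bits c × Mem m t 1)) : ℝ :=
  D.matchProb 0 (D.onCt D.supp * X * D.onCt D.supp)

end Decomp

/-- A choice of characterization for every security parameter and key. -/
structure Characterization (S : Scheme) where
  tagLen : ℕ → ℕ
  decomp : ∀ n, Bits (S.keyLen n) → Decomp (S.ptLen n) (tagLen n) (S.ctLen n)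

def Characterization.Valid {S : Scheme} (T : Characterization S) : Prop :=
  ∀ n k, (T.decomp n k).Characterizes (S.Enc n k) (S.Dec n k)

/-- The same tag states and unitaries, for the scheme that never rejects. -/
def Characterization.neverReject {S : Scheme} (T : Characterization S) :
    Characterization S.neverReject where
  tagLen := T.tagLen
  decomp := fun n k =>
    { V := (T.decomp n k).V
      p := (T.decomp n k).p
      ψ := (T.decomp n k).ψ
      Dhat := fun X => rejectToZero ((T.decomp n k).Dhat X) }

/-! ### The security games -/

/-- Oracle names: encryption only, and encryption and decryption. -/
inductive EncOnly
  | enc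

inductive EncDec
  | enc | dec

/-- Average over a uniformly random key. -/
def avgKey {κ : ℕ} (f : Bits κ → ℝ) : ℝ := (∑ k, f k) / 2 ^ κ

section games

variable (S : Scheme) (T : Characterization S)

/-- One instruction with the oracles `Enc_k` and `Dec_k`. -/
def realStep (n : ℕ) (k : Bits (S.keyLen n)) {w : ℕ} {E : Type} [Fintype E] [DecidableEq E]
    (ρ : State 0 (S.ptLen n) (S.ctLen n) w E) (g : Instr EncDec ℕ) :
    State 0 (S.ptLen n) (S.ctLen n) w E :=
  match g with
  | .query .enc => encCall (ampl E (S.Enc n k)) ρ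
  | .query .dec => decCall (ampl E (S.Dec n k)) ρ
  | g => applyGate g ρ

/-! #### Unforgeability -/

def forgeStep (n : ℕ) (k : Bits (S.keyLen n)) {w : ℕ}
    (ρ : State 0 (S.ptLen n) (S.ctLen n) w Unit) (g : Instr EncOnly ℕ) :
    State 0 (S.ptLen n) (S.ctLen n) w Unit :=
  match g with
  | .query .enc => encCall (ampl Unit (S.Enc n k)) ρ
  | g => applyGate g ρ

/-- `Pr[QUF-Forge → win]`: the final contents of register `C` decrypt to something other
than `⊥`. -/
def forgeWin (A : QPT EncOnly) (n : ℕ) : ℝ :=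
  avgKey fun k : Bits (S.keyLen n) =>
    let ρ := (A.circuit n).foldl (forgeStep S n k)
      (startState () : State 0 (S.ptLen n) (S.ctLen n) (width (A.circuit n)) Unit)
    let Y : Op (Bits (S.ctLen n)) := Matrix.of fun a b => reduceC ρ (a, ()) (b, ())
    ∑ x : Bits (S.ptLen n), (S.Dec n k Y (some x) (some x)).re

/-- Joint states of an adversary and a challenger with some number of slots. -/
abbrev SlotState (m t c w : ℕ) := Σ j : ℕ, State 0 m c w (Mem m t j)

def cheatStep (n : ℕ) (k : Bits (S.keyLen n)) {w : ℕ}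
    (ρ : SlotState (S.ptLen n) (T.tagLen n) (S.ctLen n) w) (g : Instr EncOnly ℕ) :
    SlotState (S.ptLen n) (T.tagLen n) (S.ctLen n) w :=
  match g with
  | .query .enc =>
      ⟨ρ.1 + 1, encCall (fun X => (T.decomp n k).replaceEnc ρ.1 (discardInput _ X)) ρ.2⟩
  | g => ⟨ρ.1, applyGate g ρ.2⟩

/-- `Pr[QUF-Cheat → cheat]`. -/
def forgeCheat (A : QPT EncOnly) (n : ℕ) : ℝ :=
  avgKey fun k : Bits (S.keyLen n) =>
    let ρ := (A.circuit n).foldl (cheatStep S T n k)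
      (⟨0, startState Fin.elim0⟩ :
        SlotState (S.ptLen n) (T.tagLen n) (S.ctLen n) (width (A.circuit n)))
    (T.decomp n k).cheatProb (reduceC ρ.2)

/-- Unforgeability of ciphertexts. -/
def QUF : Prop :=
  ∀ A : QPT EncOnly, ∃ ε, Negligible ε ∧
    ∀ n, |forgeWin S A n - forgeCheat S T A n| ≤ ε n

/-! #### Adaptive chosen-ciphertext security -/

/-- The joint workspace of the two phases of an adversary is `0, …, width2 A₁ A₂ n`. -/
def width2 (A₁ A₂ : QPT EncDec) (n : ℕ) : ℕ :=
  max (width (A₁.circuit n)) (width (A₂.circuit n))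

/-- Encryption of the maximally mixed state in place of the input. -/
def encMixed {m c : ℕ} (Φ : SuperOp (Bits m) (Bits c)) : SuperOp (Bits m) (Bits c) :=
  fun X => X.trace • Φ (((2 : ℂ) ^ m)⁻¹ • 1)

/-- `Pr[QCCA2-Test → win]`. The challenge plaintext is the contents of `M` after the
first phase. -/
def testWin (A₁ A₂ : QPT EncDec) (n : ℕ) : ℝ :=
  avgKey fun k : Bits (S.keyLen n) =>
    let ρ := (A₁.circuit n).foldl (realStep S n k)
      (startState () : State 0 (S.ptLen n) (S.ctLen n) (width2 A₁ A₂ n) Unit)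
    let final (Φ : SuperOp (Bits (S.ptLen n)) (Bits (S.ctLen n))) :=
      (A₂.circuit n).foldl (realStep S n k) (encCall (ampl Unit Φ) ρ)
    (outProb false (final (S.Enc n k)) + outProb true (final (encMixed (S.Enc n k)))) / 2

/-- One instruction of the second phase with the oracles `Enc_k` and the cheat-detecting
decryption oracle; the second component is the probability of having been caught so far. -/
def fakeStep (n : ℕ) (k : Bits (S.keyLen n)) {w : ℕ}
    (s : State 0 (S.ptLen n) (S.ctLen n) w (Mem (S.ptLen n) (T.tagLen n) 1) × ℝ)
    (g : Instr EncDec ℕ) :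
    State 0 (S.ptLen n) (S.ctLen n) w (Mem (S.ptLen n) (T.tagLen n) 1) × ℝ :=
  match g with
  | .query .enc => (encCall (ampl _ (S.Enc n k)) s.1, s.2)
  | .query .dec =>
      (decCall (T.decomp n k).watchDec s.1,
        s.2 + (T.decomp n k).detectProb (reduceC s.1))
  | g => (applyGate g s.1, s.2)

/-- `Pr[QCCA2-Fake → cheat]`. -/
def fakeCheat (A₁ A₂ : QPT EncDec) (n : ℕ) : ℝ :=
  avgKey fun k : Bits (S.keyLen n) =>
    let ρ := (A₁.circuit n).foldl (realStep S n k)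
      (startState Fin.elim0 : State 0 (S.ptLen n) (S.ctLen n) (width2 A₁ A₂ n)
        (Mem (S.ptLen n) (T.tagLen n) 0))
    let s := (A₂.circuit n).foldl (fakeStep S T n k)
      (encCall (fun X => (T.decomp n k).replaceEnc 0 (discardInput _ X)) ρ, (0 : ℝ))
    s.2 + s.1.trace.re / 2

/-- Indistinguishability under adaptive chosen-ciphertext attack. -/
def QINDCCA2 : Prop :=
  ∀ A₁ A₂ : QPT EncDec, ∃ ε, Negligible ε ∧
    ∀ n, testWin S A₁ A₂ n - fakeCheat S T A₁ A₂ n ≤ ε n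

/-! #### Authenticated encryption -/

/-- `Pr[QAE-Real → real]`; the output bit `1` stands for `real`. -/
def qaeReal (A : QPT EncDec) (n : ℕ) : ℝ :=
  avgKey fun k : Bits (S.keyLen n) =>
    outProb true ((A.circuit n).foldl (realStep S n k)
      (startState () : State 0 (S.ptLen n) (S.ctLen n) (width (A.circuit n)) Unit))

def idealStep (n : ℕ) (k : Bits (S.keyLen n)) {w : ℕ}
    (ρ : SlotState (S.ptLen n) (T.tagLen n) (S.ctLen n) w) (g : Instr EncDec ℕ) :
    SlotState (S.ptLen n) (T.tagLen n) (S.ctLen n) w :=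
  match g with
  | .query .enc => ⟨ρ.1 + 1, encCall ((T.decomp n k).replaceEnc ρ.1) ρ.2⟩
  | .query .dec => ⟨ρ.1, decCall ((T.decomp n k).idealDec ρ.1) ρ.2⟩
  | g => ⟨ρ.1, applyGate g ρ.2⟩

/-- `Pr[QAE-Ideal → real]`. -/
def qaeIdeal (A : QPT EncDec) (n : ℕ) : ℝ :=
  avgKey fun k : Bits (S.keyLen n) =>
    outProb true ((A.circuit n).foldl (idealStep S T n k)
      (⟨0, startState Fin.elim0⟩ :
        SlotState (S.ptLen n) (T.tagLen n) (S.ctLen n) (width (A.circuit n)))).2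

/-- Authenticated quantum encryption. -/
def QAE : Prop :=
  ∀ A : QPT EncDec, ∃ ε, Negligible ε ∧
    ∀ n, |qaeReal S A n - qaeIdeal S T A n| ≤ ε n

end games

end QEnc

end

/-! The reject symbol is stored as flag `1` with an all-zero plaintext register. Replacing it by the
all-zero plaintext is therefore the same as resetting the flag qubit (`decCall_rejectToZero`), which
an adversary can do by itself. An attack on the scheme that never rejects becomes an attack on the
original one by inserting a reset after every decryption query. The matching test does not involve
`Dhat`, and the accepted branch is unaffected by the change, so the winning probability in Test and
the cheating probability in Fake are both preserved exactly (`QINDCCA2.neverReject`). The same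
reset, put at the end of the decryption circuit, shows that the new scheme is efficient; its
correctness is exact because every characterized scheme is perfectly correct.

A scheme that never rejects is neither QUF nor QAE, whatever the characterization. With no
encryption query, any submitted ciphertext wins Forge, while Cheat has no kept pair that could be
matched (`not_QUF_of_never_rejects`). Likewise one decryption query is answered without rejection in
Real and always by rejection in Ideal, and the flag tells the two apart
(`not_QAE_of_never_rejects`). In both attacks the gap is `1`.

For the existence statement, plaintexts have length zero, the ciphertext is the key, and decryption
accepts everything. The two challenges in Test are then the same state, so the winning probability
is exactly `1/2`. In Fake, the probability of having been caught and the weight of the remaining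
state add up to `1`, so cheat has probability at least `1/2` (`QINDCCA2_of_ptLen_eq_zero`). This
balance requires positivity and trace bookkeeping for the whole circuit semantics; it is simplified
by the fact that for length zero the matching test is just a test of the tag
(`matchProj_eq_tagProj`). -/

noncomputable section

set_option linter.unusedSectionVars false

namespace QEnc

/-! ### Machines -/

section machines

variable {Ω : Type}

/-- A query selected by `sel` is followed by a reset of the qubit `z` of the flag register. -/
def Instr.thenReset {ι : Type} (sel : Ω → Bool) (z : ι) : Instr Ω ι → List (Instr Ω ι)
  | .query o => .query o :: if sel o then [.reset .F z] else []
  | g => [g]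

lemma Instr.map_reindex_thenReset {ι κ : Type} (sel : Ω → Bool) (z : ι) (f : ι → κ)
    (g : Instr Ω ι) :
    (g.thenReset sel z).map (Instr.reindex f) = (g.reindex f).thenReset sel (f z) := by
  cases g <;> simp only [Instr.thenReset, Instr.reindex, List.map_cons, List.map_nil]
  split <;> simp [Instr.reindex]

lemma Instr.reindex_reindex {ι κ μ : Type} (f : ι → κ) (h : κ → μ) (g : Instr Ω ι) :
    (g.reindex f).reindex h = g.reindex (h ∘ f) := by
  cases g <;> rfl

/-- The machine that writes the circuits of `A` with resets of the flag after the queries selected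
by `sel` and, if `fin` holds, at the end. It has one more stack, which stays empty. -/
def Machine.withResets (A : Machine Ω) (sel : Ω → Bool) (fin : Bool) : Machine Ω where
  states := A.states
  start := A.start
  numStacks := A.numStacks + 1
  step := fun q t =>
    let d := A.step q (fun i => t i.castSucc)
    (d.1, Fin.snoc (α := fun _ => StackOp) d.2.1 .keep,
      (d.2.2.map (Instr.reindex Fin.castSucc)).flatMap (Instr.thenReset sel (Fin.last _)) ++
        if fin && d.1.isNone then [.reset .F (Fin.last _)] else [])

/-- The configuration of `A.withResets sel fin` that corresponds to a configuration of `A`. -/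
def Config.withResets {A : Machine Ω} (sel : Ω → Bool) (fin : Bool) (c : Config A) :
    Config (A.withResets sel fin) where
  state := c.state
  stack := Fin.snoc (α := fun _ => List Bool) c.stack []
  out := c.out.flatMap (Instr.thenReset sel 0) ++
    if fin && c.state.isNone then [.reset .F 0] else []

/-- The simulation is step for step. The final reset is written in the very step that halts, and a
halted configuration is a fixed point, so it is written once. The additional stack is never touched,
and its height `0` supplies the address of the flag qubit. -/
lemma Machine.next_withResets (A : Machine Ω) (sel : Ω → Bool) (fin : Bool) (c : Config A) :
    (A.withResets sel fin).next (c.withResets sel fin) = (A.next c).withResets sel fin := by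
  rcases c with ⟨_ | q, stack, out⟩
  · rfl
  · have hs : (fun i : Fin (A.numStacks + 1) =>
        ((Fin.snoc (α := fun _ => List Bool) stack [] :
          Fin (A.numStacks + 1 + 1) → List Bool) i.castSucc).head?) =
          fun i => (stack i).head? := by
      funext i; rw [Fin.snoc_castSucc]
    simp only [Machine.next, Config.withResets, Machine.withResets, Config.mk.injEq]
    refine ⟨by rw [hs], ?_, ?_⟩
    · funext i
      rw [hs]
      refine Fin.lastCases ?_ (fun i => ?_) i
      · simp [StackOp.act]
      · simp only [Fin.snoc_castSucc]
    · rw [hs]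
      simp only [Option.isNone_some, Bool.and_false, Bool.false_eq_true, if_false,
        List.append_nil, List.flatMap_append, List.append_assoc, List.append_cancel_left_eq,
        List.map_append, List.map_flatMap, List.flatMap_map]
      congr 1
      · refine List.flatMap_congr fun g _ => ?_
        rw [Instr.map_reindex_thenReset, Instr.reindex_reindex]
        congr 1
        · simp
        · congr 1
          funext i
          simp
      · rw [apply_ite (List.map _)]
        simp [Instr.reindex]

lemma Machine.init_withResets (A : Machine Ω) (sel : Ω → Bool) (fin : Bool) (n : ℕ) :
    (A.withResets sel fin).init n = (A.init n).withResets sel fin := by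
  have h : (fun i : Fin (A.numStacks + 1 + 1) => if i = 0 then List.replicate n true else []) =
      Fin.snoc (α := fun _ => List Bool)
        (fun i : Fin (A.numStacks + 1) => if i = 0 then List.replicate n true else []) [] := by
    funext i
    refine Fin.lastCases ?_ (fun i => ?_) i
    · simp
    · simp
  exact congrArg (fun t => ({ state := some A.start, stack := t, out := [] } :
    Config (A.withResets sel fin))) h |>.trans
    (by cases fin <;> rfl)

lemma Machine.iterate_withResets (A : Machine Ω) (sel : Ω → Bool) (fin : Bool) (n s : ℕ) :
    (A.withResets sel fin).next^[s] ((A.withResets sel fin).init n) =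
      (A.next^[s] (A.init n)).withResets sel fin := by
  induction s with
  | zero => exact A.init_withResets sel fin n
  | succ s ih => rw [Function.iterate_succ_apply', ih, next_withResets,
      Function.iterate_succ_apply']

/-- The number of steps is unchanged, so the old time bound still serves. -/
def QPT.withResets (A : QPT Ω) (sel : Ω → Bool) (fin : Bool) : QPT Ω where
  machine := A.machine.withResets sel fin
  bound := A.bound
  halts := fun n => by
    rw [Machine.iterate_withResets]
    exact A.halts n

lemma QPT.circuit_withResets (A : QPT Ω) (sel : Ω → Bool) (fin : Bool) (n : ℕ) :
    (A.withResets sel fin).circuit n =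
      (A.circuit n).flatMap (Instr.thenReset sel 0) ++ if fin then [.reset .F 0] else [] := by
  have h := A.halts n
  rw [QPT.circuit, QPT.circuit]
  change (((A.machine.withResets sel fin).next^[A.bound.eval n])
    ((A.machine.withResets sel fin).init n)).out = _
  rw [Machine.iterate_withResets]
  simp [Config.withResets, h]

/-! ### Machines for concrete circuits -/

/-- The machine that writes a fixed list of instructions and halts; stack `1` is empty. -/
def Machine.write (l : List (Instr Ω (Fin 2))) : Machine Ω where
  states := 1
  start := 0
  numStacks := 1
  step := fun _ _ => (none, fun _ => .keep, l)

def QPT.write (l : List (Instr Ω (Fin 2))) : QPT Ω where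
  machine := .write l
  bound := 1
  halts := fun n => by simp [Machine.next, Machine.init, Machine.write]

/-- Positions are stack heights: index `0` stands for qubit `n`, and index `1`, the empty stack, for
qubit `0`. -/
lemma QPT.circuit_write (l : List (Instr Ω (Fin 2))) (n : ℕ) :
    (QPT.write l).circuit n = l.map (Instr.reindex fun i => if i = 0 then n else 0) := by
  simp only [QPT.circuit, QPT.write, Machine.next, Machine.init, Machine.write,
    Polynomial.eval_one, Function.iterate_one, List.nil_append]
  congr 2
  funext i
  change (if i = 0 then List.replicate n true else []).length = _
  by_cases h : i = 0 <;> simp [h]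

/-- The machine that writes `g` once for each letter of its input; at the `i`-th time the height
of stack `1` is `i`. -/
def Machine.emitLoop (g : Instr Ω (Fin 2)) : Machine Ω where
  states := 1
  start := 0
  numStacks := 1
  step := fun _ t =>
    if t 0 = none then (none, fun _ => .keep, [])
    else (some 0, fun i => if i = 0 then .pop else .push true, [g])

lemma Machine.iterate_emitLoop (g : Instr Ω (Fin 2)) (n s : ℕ) (hs : s ≤ n) :
    (Machine.emitLoop g).next^[s] ((Machine.emitLoop g).init n) =
      { state := some (Machine.emitLoop g).start
        stack := fun i => if i = 0 then List.replicate (n - s) true else List.replicate s true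
        out := (List.range s).map fun i => g.reindex fun j => if j = 0 then n - i else i } := by
  induction s with
  | zero => simp [Machine.init, Machine.emitLoop]
  | succ s ih =>
    rw [Function.iterate_succ_apply', ih (by omega)]
    obtain ⟨d, hd⟩ : ∃ d, n - s = d + 1 := ⟨n - s - 1, by omega⟩
    have hd2 : n - (s + 1) = d := by omega
    rw [hd, hd2, List.range_succ, List.map_append]
    refine Config.mk.injEq .. |>.mpr ⟨rfl, ?_, congrArg _ ?_⟩
    · funext i
      change (if i = 0 then StackOp.pop else StackOp.push true).act
        (if i = 0 then List.replicate (d + 1) true else List.replicate s true) = _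
      by_cases h : i = 0 <;> simp [h, StackOp.act, List.replicate_succ]
    · change [Instr.reindex (fun i => (if i = 0 then List.replicate (d + 1) true
        else List.replicate s true).length) g] = [g.reindex fun j => if j = 0 then n - s else s]
      congr 2
      funext i
      by_cases h : i = 0 <;> simp [h, hd]

def QPT.emitLoop (g : Instr Ω (Fin 2)) : QPT Ω where
  machine := .emitLoop g
  -- There are `n` pops, and one more step that finds stack `0` empty and halts.
  bound := Polynomial.X + 1
  halts := fun n => by
    simp only [Polynomial.eval_add, Polynomial.eval_X, Polynomial.eval_one]
    rw [Nat.add_one, Function.iterate_succ_apply', Machine.iterate_emitLoop g n n le_rfl]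
    simp only [Nat.sub_self, List.replicate_zero]
    rfl

lemma QPT.circuit_emitLoop (g : Instr Ω (Fin 2)) (n : ℕ) :
    (QPT.emitLoop g).circuit n =
      (List.range n).map fun i => g.reindex fun j => if j = 0 then n - i else i := by
  simp only [QPT.circuit, QPT.emitLoop, Polynomial.eval_add, Polynomial.eval_X,
    Polynomial.eval_one]
  rw [Nat.add_one, Function.iterate_succ_apply', Machine.iterate_emitLoop g n n le_rfl]
  simp only [Nat.sub_self, List.replicate_zero]
  exact List.append_nil _

/-! ### Widths -/

lemma width_append (l l' : List (Instr Ω ℕ)) : width (l ++ l') = max (width l) (width l') := by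
  induction l with
  | nil => simp [width]
  | cons g l ih =>
    simp only [width, List.cons_append, List.map_cons, List.foldr_cons] at ih ⊢
    rw [ih, max_assoc]

/-- Resets of the flag do not address the workspace, so the modified adversary has states of the
same size and the two games can be compared literally. -/
lemma width_flatMap_thenReset (sel : Ω → Bool) (l : List (Instr Ω ℕ)) :
    width (l.flatMap (Instr.thenReset sel 0)) = width l := by
  induction l with
  | nil => rfl
  | cons g l ih =>
    rw [List.flatMap_cons, width_append, ih, ← List.singleton_append (l := l), width_append]
    congr 1
    cases g <;> simp only [Instr.thenReset]
    split <;> simp [width, Instr.maxW, wPos]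

lemma width_reset_flag : width ([.reset .F 0] : List (Instr Ω ℕ)) = 0 := by
  simp [width, Instr.maxW, wPos]

end machines

/-! ### Resetting the flag -/

section reset

variable {κ m c w : ℕ} {E : Type} [Fintype E] [DecidableEq E]

lemma setReg_same (x : Basis κ m c w) (r : Reg) (a : Bits (layout κ m c w r)) :
    setReg x r a r = a := by simp [setReg]

lemma setReg_of_ne (x : Basis κ m c w) {r s : Reg} (h : s ≠ r) (a : Bits (layout κ m c w r)) :
    setReg x r a s = x s := by simp [setReg, h]

lemma setReg_setReg (x : Basis κ m c w) (r : Reg) (a b : Bits (layout κ m c w r)) :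
    setReg (setReg x r a) r b = setReg x r b := by simp [setReg]

lemma setReg_comm (x : Basis κ m c w) {r s : Reg} (h : r ≠ s) (a : Bits (layout κ m c w r))
    (b : Bits (layout κ m c w s)) :
    setReg (setReg x r a) s b = setReg (setReg x s b) r a :=
  Function.update_comm h _ _ _

lemma update_bits_one (f : Bits 1) (b : Bool) : Function.update f 0 b = fun _ => b := by
  funext i; rw [Subsingleton.elim i 0]; simp

lemma setWire_flag (x : Basis κ m c w) (b : Bool) :
    setWire x .F (0 : Fin 1) b = setReg x .F (fun _ => b) := by
  rw [setWire]; congr 1; exact update_bits_one _ _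

lemma bits_one_eq (f : Bits 1) : f = fun _ => f 0 := by
  funext i; rw [Subsingleton.elim i 0]

lemma sum_bits_one {M : Type} [AddCommMonoid M] (f : Bits 1 → M) :
    ∑ b, f b = f (fun _ => false) + f (fun _ => true) := by
  rw [← (Equiv.funUnique (Fin 1) Bool).symm.sum_comp f, Fintype.sum_bool, add_comm]
  rfl

lemma resetWire_flag_apply (ρ : State κ m c w E) (p q : Basis κ m c w × E) :
    resetWire .F (0 : Fin 1) ρ p q =
      if p.1 .F = zeros ∧ q.1 .F = zeros then
        ∑ b : Bits 1, ρ (setReg p.1 .F b, p.2) (setReg q.1 .F b, q.2) else 0 := by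
  have h : ∀ f : Bits 1, f 0 = false ↔ f = zeros := fun f =>
    ⟨fun h => by rw [bits_one_eq f, h]; rfl, fun h => by rw [h]; rfl⟩
  simp only [resetWire, Matrix.of_apply, setWire_flag, Fintype.sum_bool, sum_bits_one,
    h (p.1 Reg.F), h (q.1 Reg.F), add_comm]

lemma applyGate_reset_flag {Ω : Type} (ρ : State κ m c w E) :
    applyGate (.reset .F 0 : Instr Ω ℕ) ρ = resetWire .F (0 : Fin 1) ρ := by
  simp [applyGate]

lemma unflag_false (μ : Bits m) : unflag μ (fun _ => false) = some (some μ) := by simp [unflag]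

lemma unflag_true (μ : Bits m) :
    unflag μ (fun _ => true) = if μ = zeros then some none else none := by simp [unflag]

lemma rejectToZero_some_some (X : Op (Option (Bits m))) (x y : Bits m) :
    rejectToZero X (some x) (some y) =
      X (some x) (some y) + if x = zeros ∧ y = zeros then X none none else 0 := rfl

lemma rejectToZero_none_left (X : Op (Option (Bits m))) (o : Option (Bits m)) :
    rejectToZero X none o = 0 := rfl

lemma rejectToZero_none_right (X : Op (Option (Bits m))) (o : Option (Bits m)) :
    rejectToZero X o none = 0 := by cases o <;> rfl

lemma rejectToZero_add (X Y : Op (Option (Bits m))) :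
    rejectToZero (X + Y) = rejectToZero X + rejectToZero Y := by
  ext (_ | x) (_ | y)
  · exact (add_zero 0).symm
  · exact (add_zero 0).symm
  · exact (add_zero 0).symm
  · simp only [rejectToZero_some_some, Matrix.add_apply]
    split_ifs <;> ring

lemma rejectToZero_embed (X : Op (Bits m)) : rejectToZero (embed X) = embed X := by
  ext (_ | x) (_ | y)
  · rfl
  · rfl
  · rfl
  · simp [rejectToZero_some_some, embed]

/-- The value of a response to a decryption query at flags `f` and `g`. -/
def flagged (Y : Op (Option (Bits m))) (p q : Bits m × Bits 1) : ℂ :=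
  match unflag p.1 p.2, unflag q.1 q.2 with
  | some o, some o2 => Y o o2
  | _, _ => 0

/-- Flag `1` occurs only with the all-zero plaintext. Summing over the flag therefore adds the
weight of `⊥` to the all-zero diagonal entry and changes nothing else. -/
lemma flagged_rejectToZero (Y : Op (Option (Bits m))) (p q : Bits m × Bits 1) :
    flagged (rejectToZero Y) p q =
      if p.2 = zeros ∧ q.2 = zeros then ∑ b, flagged Y (p.1, b) (q.1, b) else 0 := by
  obtain ⟨μ, f⟩ := p
  obtain ⟨ν, g⟩ := q
  have hz : (zeros : Bits 1) = fun _ => false := rfl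
  have hn : (fun _ : Fin 1 => true) ≠ fun _ => false := fun h => by simpa using congrFun h 0
  rw [sum_bits_one]
  obtain hf | hf : f = (fun _ => false) ∨ f = fun _ => true := by
    rw [bits_one_eq f]; cases f 0 <;> simp
  · obtain hg | hg : g = (fun _ => false) ∨ g = fun _ => true := by
      rw [bits_one_eq g]; cases g 0 <;> simp
    · simp only [hf, hg, hz, and_self, if_true, flagged, unflag_false, unflag_true,
        rejectToZero_some_some]
      congr 1
      by_cases hμ : μ = zeros <;> by_cases hν : ν = zeros <;> simp [hμ, hν]
    · simp only [hf, hg, hz, hn, and_false, if_false, flagged, unflag_false, unflag_true]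
      by_cases hν : ν = zeros <;> simp [hν, rejectToZero_none_right]
  · simp only [hf, hz, hn, false_and, if_false, flagged, unflag_true]
    by_cases hμ : μ = zeros
    · cases unflag ν g <;> simp [hμ, rejectToZero_none_left]
    · simp [hμ]

/-- The query register and memory, and the response, of a decryption query. -/
def decInput (ρ : State κ m c w E) (x y : Basis κ m c w) : Op (Bits c × E) :=
  Matrix.of fun a b => ∑ u : Bits m, ∑ f : Bits 1,
    ρ (setReg (setReg (setReg x .M u) .F f) .C a.1, a.2)
      (setReg (setReg (setReg y .M u) .F f) .C b.1, b.2)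

lemma decCall_apply {E2 : Type} (Ψ : SuperOp (Bits c × E) (Option (Bits m) × E2))
    (ρ : State κ m c w E) (p q : Basis κ m c w × E2) :
    decCall Ψ ρ p q =
      if p.1 .C = zeros ∧ q.1 .C = zeros ∧ p.1 .F = q.1 .F then
        flagged (Matrix.of fun o o2 => Ψ (decInput ρ p.1 q.1) (o, p.2) (o2, q.2))
          (p.1 .M, p.1 .F) (q.1 .M, q.1 .F)
      else 0 := by
  simp only [decCall, flagged, decInput, Matrix.of_apply]
  congr 1
  cases unflag (p.1 .M) (p.1 .F) <;> cases unflag (q.1 .M) (q.1 .F) <;> rfl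

lemma decInput_setReg_flag (ρ : State κ m c w E) (x y : Basis κ m c w) (f g : Bits 1) :
    decInput ρ (setReg x .F f) (setReg y .F g) = decInput ρ x y := by
  unfold decInput
  congr! 7 with a b u _ f'
  · rw [setReg_comm x (by decide : Reg.F ≠ Reg.M), setReg_setReg]
  · rw [setReg_comm y (by decide : Reg.F ≠ Reg.M), setReg_setReg]

/-- This is the heart of the reduction: the change of the oracle is an operation on the adversary's
own register. The oracle `Ψ` and its memory are arbitrary because the identity serves both the real
and the cheat-detecting decryption oracle. -/
lemma decCall_rejectToZero {E2 : Type} [Fintype E2] [DecidableEq E2]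
    (Ψ : SuperOp (Bits c × E) (Option (Bits m) × E2)) (ρ : State κ m c w E) :
    decCall (fun X => ampl E2 rejectToZero (Ψ X)) ρ = resetWire .F (0 : Fin 1) (decCall Ψ ρ) := by
  ext p q
  have h : ∀ Z : Op (Option (Bits m) × E2),
      (Matrix.of fun o o2 => ampl E2 rejectToZero Z (o, p.2) (o2, q.2)) =
        rejectToZero (Matrix.of fun o o2 => Z (o, p.2) (o2, q.2)) := fun _ => rfl
  rw [resetWire_flag_apply, decCall_apply, h]
  simp only [decCall_apply, decInput_setReg_flag, setReg_same, flagged_rejectToZero, and_true,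
    setReg_of_ne _ (by decide : Reg.C ≠ Reg.F), setReg_of_ne _ (by decide : Reg.M ≠ Reg.F)]
  by_cases hp : p.1 .F = zeros <;> by_cases hq : q.1 .F = zeros <;> simp [hp, hq]

end reset

/-- The accepted branch returns a plaintext, which `rejectToZero` fixes; the change to `Dhat` is the
whole effect. -/
lemma Decomp.watchDec_rejectToZero {m t c : ℕ} (D : Decomp m t c)
    (X : Op (Bits c × Mem m t 1)) :
    ({ D with Dhat := fun X => rejectToZero (D.Dhat X) } : Decomp m t c).watchDec X =
      ampl _ rejectToZero (D.watchDec X) := by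
  have h : ∀ Z Z' : Op (Option (Bits m) × Mem m t 1),
      ampl (Mem m t 1) rejectToZero (Z + Z') = ampl _ rejectToZero Z + ampl _ rejectToZero Z' := by
    intro Z Z'
    ext p q
    exact congrFun (congrFun (rejectToZero_add (Matrix.of fun a b => Z (a, p.2) (b, q.2))
      (Matrix.of fun a b => Z' (a, p.2) (b, q.2))) p.1) q.1
  have h2 : ∀ Z, ampl (Mem m t 1) rejectToZero
      (ampl _ (fun Y => embed (traceTag (D.undo Y))) Z) =
        ampl _ (fun Y => embed (traceTag (D.undo Y))) Z := by
    intro Z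
    ext p q
    exact congrFun (congrFun (rejectToZero_embed _) p.1) q.1
  conv_rhs => rw [watchDec, h, h2]
  rfl

lemma foldl_eq_foldl_flatMap {α β : Type} {f f' : α → β → α} {e : β → List β}
    (h : ∀ a b, f' a b = (e b).foldl f a) (l : List β) (a : α) :
    l.foldl f' a = (l.flatMap e).foldl f a := by
  induction l generalizing a with
  | nil => rfl
  | cons b l ih => rw [List.flatMap_cons, List.foldl_append, List.foldl_cons, h, ih]

/-! ### The reduction -/

def EncDec.isDec : EncDec → Bool
  | .enc => false
  | .dec => true

section games

variable (S : Scheme) (T : Characterization S)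

lemma realStep_neverReject (n : ℕ) (k : Bits (S.keyLen n)) {w : ℕ} {E : Type} [Fintype E]
    [DecidableEq E] (ρ : State 0 (S.ptLen n) (S.ctLen n) w E) (g : Instr EncDec ℕ) :
    realStep S.neverReject n k ρ g =
      (g.thenReset EncDec.isDec 0).foldl (realStep S n k) ρ := by
  rcases g with _ | _ | _ | _ | ⟨_ | _⟩
  all_goals first | rfl | skip
  change decCall (fun X => ampl E rejectToZero (ampl E (S.Dec n k) X)) ρ =
    applyGate (.reset .F 0 : Instr EncDec ℕ) (decCall (ampl E (S.Dec n k)) ρ)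
  rw [decCall_rejectToZero, applyGate_reset_flag]

/-- The detection probability depends only on `V`, `p` and `ψ`, which both characterizations share,
and resets do not change the record of it. -/
lemma fakeStep_neverReject (n : ℕ) (k : Bits (S.keyLen n)) {w : ℕ}
    (s : State 0 (S.ptLen n) (S.ctLen n) w (Mem (S.ptLen n) (T.tagLen n) 1) × ℝ)
    (g : Instr EncDec ℕ) :
    fakeStep S.neverReject T.neverReject n k s g =
      (g.thenReset EncDec.isDec 0).foldl (fakeStep S T n k) s := by
  rcases g with _ | _ | _ | _ | ⟨_ | _⟩
  all_goals first | rfl | skip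
  change (decCall (T.neverReject.decomp n k).watchDec s.1, _) =
    (applyGate (.reset .F 0 : Instr EncDec ℕ) (decCall (T.decomp n k).watchDec s.1), _)
  rw [applyGate_reset_flag, ← decCall_rejectToZero]
  exact congrArg₂ Prod.mk (congrArg (decCall · s.1)
    (funext fun X => (T.decomp n k).watchDec_rejectToZero X)) rfl

/-- `testWin` for given circuits, workspace, instruction semantics and encryption map. -/
def testWinOf {m c w : ℕ} (step : State 0 m c w Unit → Instr EncDec ℕ → State 0 m c w Unit)
    (Enc : SuperOp (Bits m) (Bits c)) (l₁ l₂ : List (Instr EncDec ℕ)) : ℝ :=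
  let ρ := l₁.foldl step (startState () : State 0 m c w Unit)
  let final (Φ : SuperOp (Bits m) (Bits c)) := l₂.foldl step (encCall (ampl Unit Φ) ρ)
  (outProb false (final Enc) + outProb true (final (encMixed Enc))) / 2

/-- `fakeCheat` for given circuits, workspace, instruction semantics and characterization. -/
def fakeCheatOf {m t c w : ℕ} (D : Decomp m t c)
    (step₁ : State 0 m c w (Mem m t 0) → Instr EncDec ℕ → State 0 m c w (Mem m t 0))
    (step₂ : State 0 m c w (Mem m t 1) × ℝ → Instr EncDec ℕ → State 0 m c w (Mem m t 1) × ℝ)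
    (l₁ l₂ : List (Instr EncDec ℕ)) : ℝ :=
  let ρ := l₁.foldl step₁ (startState Fin.elim0 : State 0 m c w (Mem m t 0))
  let s := l₂.foldl step₂ (encCall (fun X => D.replaceEnc 0 (discardInput _ X)) ρ, (0 : ℝ))
  s.2 + s.1.trace.re / 2

lemma testWin_eq (A₁ A₂ : QPT EncDec) (n : ℕ) :
    testWin S A₁ A₂ n = avgKey fun k => testWinOf (w := width2 A₁ A₂ n) (realStep S n k)
      (S.Enc n k) (A₁.circuit n) (A₂.circuit n) := rfl

lemma fakeCheat_eq (A₁ A₂ : QPT EncDec) (n : ℕ) :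
    fakeCheat S T A₁ A₂ n = avgKey fun k => fakeCheatOf (w := width2 A₁ A₂ n) (T.decomp n k)
      (realStep S n k) (fakeStep S T n k) (A₁.circuit n) (A₂.circuit n) := rfl

lemma testWinOf_neverReject (n : ℕ) (k : Bits (S.keyLen n)) (w : ℕ)
    (l₁ l₂ : List (Instr EncDec ℕ)) :
    testWinOf (w := w) (realStep S.neverReject n k) (S.neverReject.Enc n k) l₁ l₂ =
      testWinOf (w := w) (realStep S n k) (S.Enc n k)
        (l₁.flatMap (Instr.thenReset EncDec.isDec 0))
        (l₂.flatMap (Instr.thenReset EncDec.isDec 0)) := by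
  simp only [testWinOf, ← foldl_eq_foldl_flatMap (realStep_neverReject S n k)]
  rfl

lemma fakeCheatOf_neverReject (n : ℕ) (k : Bits (S.keyLen n)) (w : ℕ)
    (l₁ l₂ : List (Instr EncDec ℕ)) :
    fakeCheatOf (w := w) (T.neverReject.decomp n k) (realStep S.neverReject n k)
      (fakeStep S.neverReject T.neverReject n k) l₁ l₂ =
      fakeCheatOf (w := w) (T.decomp n k) (realStep S n k) (fakeStep S T n k)
        (l₁.flatMap (Instr.thenReset EncDec.isDec 0))
        (l₂.flatMap (Instr.thenReset EncDec.isDec 0)) := by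
  simp only [fakeCheatOf, ← foldl_eq_foldl_flatMap (realStep_neverReject S n k),
    ← foldl_eq_foldl_flatMap (fakeStep_neverReject S T n k)]
  rfl

/-- The reduction is lossless: the modified adversary has the same two probabilities against `S`, so
the same `ε` works. -/
theorem QINDCCA2.neverReject {S : Scheme} {T : Characterization S} (h : QINDCCA2 S T) :
    QINDCCA2 S.neverReject T.neverReject := by
  intro A₁ A₂
  obtain ⟨ε, hε, hle⟩ :=
    h (A₁.withResets EncDec.isDec false) (A₂.withResets EncDec.isDec false)
  refine ⟨ε, hε, fun n => ?_⟩
  have hc : ∀ A : QPT EncDec, (A.withResets EncDec.isDec false).circuit n =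
      (A.circuit n).flatMap (Instr.thenReset EncDec.isDec 0) := fun A => by
    rw [QPT.circuit_withResets]; simp
  have hw : width2 (A₁.withResets EncDec.isDec false) (A₂.withResets EncDec.isDec false) n =
      width2 A₁ A₂ n := by
    rw [width2, width2, hc, hc, width_flatMap_thenReset, width_flatMap_thenReset]
  have := hle n
  rw [testWin_eq, fakeCheat_eq, hw, hc, hc] at this
  simp only [← testWinOf_neverReject, ← fakeCheatOf_neverReject] at this
  exact this

end games

/-! ### Channels -/

section channels

variable {α β γ : Type} [Fintype α] [DecidableEq α] [Fintype β] [DecidableEq β] [Fintype γ]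
  [DecidableEq γ]

lemma IsChannel.of_kraus {ι : Type} [Fintype ι] {Φ : SuperOp α β} (K : ι → Matrix β α ℂ)
    (hK : ∀ X, Φ X = ∑ i, K i * X * (K i)ᴴ) (h1 : ∑ i, (K i)ᴴ * K i = 1) : IsChannel Φ := by
  refine ⟨Fintype.card ι, fun i => K ((Fintype.equivFin ι).symm i), fun X => ?_, ?_⟩
  · rw [hK, ← (Fintype.equivFin ι).symm.sum_comp]
  · rw [← h1, ← (Fintype.equivFin ι).symm.sum_comp]

lemma IsChannel.comp {Ψ : SuperOp β γ} {Φ : SuperOp α β} (hΨ : IsChannel Ψ) (hΦ : IsChannel Φ) :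
    IsChannel fun X => Ψ (Φ X) := by
  obtain ⟨s, K, hK, hK1⟩ := hΦ
  obtain ⟨t, L, hL, hL1⟩ := hΨ
  refine .of_kraus (fun i : Fin t × Fin s => L i.1 * K i.2) (fun X => ?_) ?_
  · simp only [hL, hK, Matrix.mul_sum, Matrix.sum_mul, Fintype.sum_prod_type,
      Matrix.conjTranspose_mul, Matrix.mul_assoc]
  · rw [Fintype.sum_prod_type_right, ← hK1]
    refine Finset.sum_congr rfl fun i _ => ?_
    simp only [Matrix.conjTranspose_mul]
    calc ∑ j, (K i)ᴴ * (L j)ᴴ * (L j * K i) = (K i)ᴴ * (∑ j, (L j)ᴴ * L j) * K i := by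
          simp only [Matrix.mul_sum, Matrix.sum_mul, Matrix.mul_assoc]
      _ = _ := by rw [hL1, Matrix.mul_one]

lemma IsChannel.map_zero {Φ : SuperOp α β} (h : IsChannel Φ) : Φ 0 = 0 := by
  obtain ⟨s, K, hK, -⟩ := h
  simp [hK]

lemma IsChannel.map_smul {Φ : SuperOp α β} (h : IsChannel Φ) (a : ℂ) (X : Op α) :
    Φ (a • X) = a • Φ X := by
  obtain ⟨s, K, hK, -⟩ := h
  simp [hK, Finset.smul_sum]

lemma IsChannel.trace {Φ : SuperOp α β} (h : IsChannel Φ) (X : Op α) :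
    (Φ X).trace = X.trace := by
  obtain ⟨s, K, hK, h1⟩ := h
  rw [hK, Matrix.trace_sum]
  rw [Finset.sum_congr rfl fun i _ => (Matrix.trace_mul_comm (K i * X) (K i)ᴴ).trans
    (congrArg Matrix.trace (Matrix.mul_assoc _ _ _).symm)]
  rw [← Matrix.trace_sum, ← Finset.sum_mul, h1, Matrix.one_mul]

lemma isChannel_rejectToZero {m : ℕ} : IsChannel (rejectToZero (m := m)) := by
  -- The Kraus operators are `|0…0⟩⟨⊥|` and the projector onto the plaintexts.
  let d : Option (Bits m) → ℂ := fun o => if o = none then 0 else 1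
  refine .of_kraus (fun b : Bool => if b then Matrix.single (some zeros) none 1
    else Matrix.diagonal d) (fun X => ?_) ?_
  · rw [Fintype.sum_bool, if_pos rfl, if_neg Bool.false_ne_true, Matrix.conjTranspose_single,
      Matrix.single_mul_mul_single, Matrix.diagonal_conjTranspose]
    ext (_ | x) (_ | y)
    · simp [rejectToZero_none_left, d]
    · simp [rejectToZero_none_left, d]
    · simp [rejectToZero_none_right, d]
    · simp [rejectToZero_some_some, d, Matrix.single_apply, add_comm, eq_comm]
  · rw [Fintype.sum_bool, if_pos rfl, if_neg Bool.false_ne_true, Matrix.conjTranspose_single,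
      Matrix.single_mul_single_same, Matrix.diagonal_conjTranspose, Matrix.diagonal_mul_diagonal]
    ext (_ | x) (_ | y)
    · simp [d]
    · simp [d]
    · simp [d]
    · simp [d, Matrix.diagonal_apply, Matrix.one_apply]

end channels

/-! ### The scheme that never rejects -/

lemma traceNorm_zero {α : Type} [Fintype α] [DecidableEq α] : traceNorm (0 : Op α) = 0 := by
  have h := (Matrix.isHermitian_conjTranspose_mul_self (0 : Op α)).eigenvalues_eq_zero_iff.mpr
    (by simp)
  exact Finset.sum_eq_zero fun i _ => by rw [congrFun h i]; exact Real.sqrt_zero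

lemma diamondLE_self {α β : Type} [Fintype α] [Fintype β] [DecidableEq β]
    (Φ : SuperOp α β) : DiamondLE Φ Φ 0 := by
  intro d ρ _
  rw [sub_self, traceNorm_zero]

lemma negligible_zero : Negligible fun _ => 0 := by
  intro k
  simp

lemma not_negligible_of_one_le {ε : ℕ → ℝ} (h : ∀ n, 1 ≤ ε n) : ¬ Negligible ε := by
  intro hε
  -- Exponent `0` in superpolynomial decay says that `ε` tends to `0`.
  have h0 := hε 0
  simp only [pow_zero, one_mul] at h0
  exact absurd (ge_of_tendsto' h0 h) (by norm_num)

/-! ### Tag projectors and perfect correctness -/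

namespace Decomp

variable {m t c : ℕ} {D : Decomp m t c} {Enc : SuperOp (Bits m) (Bits c)}
  {Dec : SuperOp (Bits c) (Option (Bits m))}

lemma tagPure_mul_tagPure (h : D.Characterizes Enc Dec) (r s : Bits t) :
    D.tagPure r * D.tagPure s = if r = s then D.tagPure r else 0 := by
  rw [tagPure, tagPure, Matrix.vecMulVec_mul_vecMulVec, h.orthonormal]
  split_ifs with hrs
  · subst hrs; simp
  · simp

lemma supp_mul_tagPure (h : D.Characterizes Enc Dec) (r : Bits t) :
    D.supp * D.tagPure r = if D.p r = 0 then 0 else D.tagPure r := by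
  simp only [supp, Finset.sum_mul, ite_mul, zero_mul, tagPure_mul_tagPure h]
  rw [Finset.sum_eq_single r]
  · simp
  · intro b _ hb; simp [hb]
  · simp

lemma conjTranspose_tagPure (r : Bits t) : (D.tagPure r)ᴴ = D.tagPure r := by
  simp [tagPure, Matrix.conjTranspose_vecMulVec]

lemma conjTranspose_supp : D.suppᴴ = D.supp := by
  simp only [supp, Matrix.conjTranspose_sum]
  refine Finset.sum_congr rfl fun r _ => ?_
  split_ifs
  · simp
  · exact conjTranspose_tagPure r

lemma conjTranspose_σ : D.σᴴ = D.σ := by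
  simp [σ, Matrix.conjTranspose_sum, conjTranspose_tagPure]

lemma supp_mul_supp (h : D.Characterizes Enc Dec) : D.supp * D.supp = D.supp := by
  have h2 : D.supp * D.supp = ∑ r, D.supp * if D.p r = 0 then 0 else D.tagPure r := by
    rw [← Finset.mul_sum]; rfl
  rw [h2]
  refine Finset.sum_congr rfl fun r _ => ?_
  split_ifs with hr
  · simp
  · rw [supp_mul_tagPure h, if_neg hr]

lemma supp_mul_σ (h : D.Characterizes Enc Dec) : D.supp * D.σ = D.σ := by
  simp only [σ, Finset.mul_sum, Matrix.mul_smul, supp_mul_tagPure h]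
  refine Finset.sum_congr rfl fun r _ => ?_
  split_ifs with hr <;> simp [hr]

lemma trace_σ (h : D.Characterizes Enc Dec) : D.σ.trace = 1 := by
  have ht : ∀ r, (D.tagPure r).trace = 1 := fun r => by
    rw [tagPure, Matrix.trace_vecMulVec, dotProduct_comm, h.orthonormal, if_pos rfl]
  rw [σ, Matrix.trace_sum]
  simp only [Matrix.trace_smul, ht, smul_eq_mul, mul_one]
  exact_mod_cast h.p_sum

lemma traceTag_kronecker (X : Op (Bits m)) (B : Op (Bits t)) :
    traceTag (X ⊗ₖ B) = B.trace • X := by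
  ext x y
  simp [traceTag, Matrix.trace, ← Finset.mul_sum, mul_comm]

/-- A characterized scheme is perfectly correct. -/
lemma Characterizes.dec_enc (h : D.Characterizes Enc Dec) (X : Op (Bits m)) :
    Dec (Enc X) = embed X := by
  have hu : D.undo (Enc X) = X ⊗ₖ D.σ := by
    rw [undo, h.enc_eq]
    calc D.Vᴴ * (D.V * X ⊗ₖ D.σ * D.Vᴴ) * D.V = D.Vᴴ * D.V * X ⊗ₖ D.σ * (D.Vᴴ * D.V) := by
          simp only [Matrix.mul_assoc]
      _ = _ := by rw [h.isometry, Matrix.one_mul, Matrix.mul_one]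
  have hσ : D.σ * D.supp = D.σ := by
    have := congrArg Matrix.conjTranspose (supp_mul_σ h)
    rwa [Matrix.conjTranspose_mul, conjTranspose_σ, conjTranspose_supp] at this
  -- Since `σ` lives on its support, `Dhat` receives `0`, and tracing out the tag leaves the factor
  -- `tr σ = 1`.
  rw [h.dec_eq, hu, onTag, onTag, ← Matrix.mul_kronecker_mul, ← Matrix.mul_kronecker_mul,
    ← Matrix.mul_kronecker_mul, Matrix.sub_mul, Matrix.one_mul (D.σ), supp_mul_σ h, hσ, sub_self,
    Matrix.kronecker_zero, Matrix.zero_mul, h.channel.map_zero, add_zero, Matrix.one_mul,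
    Matrix.mul_one, traceTag_kronecker, trace_σ h, one_smul]

/-- On the accepted branch `rejectToZero` is the identity, so by additivity it can be absorbed into
`Dhat`. -/
lemma Characterizes.neverReject (h : D.Characterizes Enc Dec) :
    ({ D with Dhat := fun X => rejectToZero (D.Dhat X) } : Decomp m t c).Characterizes Enc
      fun Y => rejectToZero (Dec Y) where
  isometry := h.isometry
  coisometry := h.coisometry
  p_nonneg := h.p_nonneg
  p_sum := h.p_sum
  orthonormal := h.orthonormal
  channel := isChannel_rejectToZero.comp h.channel
  enc_eq := h.enc_eq
  dec_eq := fun Y => by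
    rw [h.dec_eq, rejectToZero_add, rejectToZero_embed]
    rfl

end Decomp

theorem Characterization.Valid.neverReject {S : Scheme} {T : Characterization S} (h : T.Valid) :
    T.neverReject.Valid :=
  fun n k => (h n k).neverReject

theorem Characterization.Valid.correct {S : Scheme} {T : Characterization S} (h : T.Valid) :
    ∃ ε, Negligible ε ∧ ∀ n k, DiamondLE (fun X => S.Dec n k (S.Enc n k X)) embed (ε n) := by
  refine ⟨fun _ => 0, negligible_zero, fun n k => ?_⟩
  rw [funext fun X => (h n k).dec_enc X]
  exact diamondLE_self _

/-! ### Decryption circuits with a final reset of the flag -/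

section registers

variable {κ m c w : ℕ}

/-- The basis label with the given register contents. -/
def mkBasis (k : Bits κ) (μ : Bits m) (f : Bits 1) (γ : Bits c) (ω : Bits (w + 1)) :
    Basis κ m c w
  | .K => k
  | .M => μ
  | .F => f
  | .C => γ
  | .W => ω

def basisEquiv : Bits κ × Bits m × Bits 1 × Bits c × Bits (w + 1) ≃ Basis κ m c w where
  toFun x := mkBasis x.1 x.2.1 x.2.2.1 x.2.2.2.1 x.2.2.2.2
  invFun x := (x .K, x .M, x .F, x .C, x .W)
  left_inv _ := rfl
  right_inv x := by funext r; cases r <;> rfl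

lemma sum_basis {A : Type} [AddCommMonoid A] (f : Basis κ m c w → A) :
    ∑ x, f x = ∑ k, ∑ μ, ∑ φ, ∑ γ, ∑ ω, f (mkBasis k μ φ γ ω) := by
  rw [← basisEquiv.sum_comp f]
  simp only [Fintype.sum_prod_type]
  rfl

variable (k : Bits κ) (μ : Bits m) (f : Bits 1) (γ : Bits c) (ω : Bits (w + 1))

lemma mkBasis_K : mkBasis k μ f γ ω .K = k := rfl
lemma mkBasis_M : mkBasis k μ f γ ω .M = μ := rfl
lemma mkBasis_F : mkBasis k μ f γ ω .F = f := rfl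
lemma mkBasis_C : mkBasis k μ f γ ω .C = γ := rfl
lemma mkBasis_W : mkBasis k μ f γ ω .W = ω := rfl

lemma setReg_mkBasis_M (a : Bits m) : setReg (mkBasis k μ f γ ω) .M a = mkBasis k a f γ ω := by
  funext r; cases r <;> rfl

lemma setReg_mkBasis_F (a : Bits 1) : setReg (mkBasis k μ f γ ω) .F a = mkBasis k μ a γ ω := by
  funext r; cases r <;> rfl

lemma setReg_mkBasis_C (a : Bits c) : setReg (mkBasis k μ f γ ω) .C a = mkBasis k μ f a ω := by
  funext r; cases r <;> rfl

lemma reduceMF_apply (ρ : State κ m c w Unit) (p q : Bits m × Bits 1) :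
    reduceMF ρ p q = ∑ k, ∑ γ, ∑ ω,
      ρ (mkBasis k p.1 p.2 γ ω, ()) (mkBasis k q.1 q.2 γ ω, ()) := by
  simp only [reduceMF, Matrix.of_apply, sum_basis, mkBasis_M, mkBasis_F, setReg_mkBasis_M,
    setReg_mkBasis_F, ite_and]
  refine Finset.sum_congr rfl fun k _ => ?_
  rw [Finset.sum_eq_single p.1 (by intro b _ hb; simp [hb]) (by simp),
    Finset.sum_eq_single p.2 (by intro b _ hb; simp [hb]) (by simp)]
  simp

lemma reduceMF_resetWire_flag (ρ : State κ m c w Unit) (p q : Bits m × Bits 1) :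
    reduceMF (resetWire .F (0 : Fin 1) ρ) p q =
      if p.2 = zeros ∧ q.2 = zeros then ∑ b : Bits 1, reduceMF ρ (p.1, b) (q.1, b) else 0 := by
  simp only [reduceMF_apply, resetWire_flag_apply, mkBasis_F, setReg_mkBasis_F]
  by_cases h : p.2 = zeros ∧ q.2 = zeros
  · simp only [if_pos h, sum_bits_one, Finset.sum_add_distrib]
  · simp [h]

/-- `ComputesDec` for a given workspace. -/
def ComputesDecWith (w : ℕ) (l : List (Instr Empty ℕ)) (k : Bits κ)
    (Φ : SuperOp (Bits c) (Option (Bits m))) : Prop :=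
  ∀ Y : Op (Bits c),
    reduceMF (l.foldl (fun ρ g => applyGate g ρ) (loadState (m := m) w k .C Y)) =
      Matrix.of fun p q => flagged (Φ Y) p q

lemma computesDec_iff (l : List (Instr Empty ℕ)) (k : Bits κ)
    (Φ : SuperOp (Bits c) (Option (Bits m))) :
    ComputesDec l k Φ ↔ ComputesDecWith (width l) l k Φ := by
  rfl

/-- The identity `flagged_rejectToZero` that governs oracle calls also governs the output of the
decryption circuit. -/
lemma ComputesDec.append_reset {l : List (Instr Empty ℕ)} {k : Bits κ}
    {Φ : SuperOp (Bits c) (Option (Bits m))} (h : ComputesDec l k Φ) :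
    ComputesDec (l ++ [.reset .F 0]) k fun Y => rejectToZero (Φ Y) := by
  rw [computesDec_iff] at h ⊢
  rw [width_append, width_reset_flag, Nat.max_zero]
  intro Y
  rw [List.foldl_append, List.foldl_cons, List.foldl_nil, applyGate_reset_flag]
  ext p q
  rw [reduceMF_resetWire_flag, h Y]
  simp only [Matrix.of_apply, flagged_rejectToZero]

end registers

theorem IsSKQES.neverReject {S : Scheme} {T : Characterization S} (h : IsSKQES S)
    (hT : T.Valid) : IsSKQES S.neverReject where
  keyLen_poly := h.keyLen_poly
  ptLen_poly := h.ptLen_poly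
  ctLen_poly := h.ctLen_poly
  enc_channel := h.enc_channel
  dec_channel := fun n k => isChannel_rejectToZero.comp (h.dec_channel n k)
  enc_qpt := h.enc_qpt
  dec_qpt := by
    obtain ⟨A, hA⟩ := h.dec_qpt
    refine ⟨A.withResets (fun _ => false) true, fun n k => ?_⟩
    -- Nothing is selected for an inner reset; only the final one is added.
    have he : (A.circuit n).flatMap (Instr.thenReset (fun _ => false) 0) = A.circuit n := by
      refine (List.flatMap_congr fun g _ => ?_).trans (List.flatMap_singleton' _)
      cases g <;> rfl
    rw [QPT.circuit_withResets, he, if_pos rfl]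
    exact (hA n k).append_reset
  correct := hT.neverReject.correct

/-! ### Attacks on schemes that never reject -/

lemma avgKey_const {κ : ℕ} (a : ℝ) : avgKey (fun _ : Bits κ => a) = a := by
  simp [avgKey]

section flagged

variable {m : ℕ} {Y : Op (Option (Bits m))} {μ : Bits m} {f : Bits 1}

lemma flagged_eq_of_flag_false (hf : f = fun _ => false) :
    flagged Y (μ, f) (μ, f) = Y (some μ) (some μ) := by
  simp only [flagged, hf, unflag_false]

lemma flagged_eq_of_flag_true (hf : f = fun _ => true) (hμ : μ = zeros) :
    flagged Y (μ, f) (μ, f) = Y none none := by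
  simp only [flagged, hf, unflag_true, if_pos hμ]

lemma flagged_eq_zero (hf : f = fun _ => true) (hμ : μ ≠ zeros) :
    flagged Y (μ, f) (μ, f) = 0 := by
  simp only [flagged, hf, unflag_true, if_neg hμ]

end flagged

section attacks

variable {κ m c w : ℕ} {E : Type} [Fintype E] [DecidableEq E]

lemma trace_reduceC (ρ : State κ m c w E) : (reduceC ρ).trace = ρ.trace := by
  simp only [Matrix.trace, Matrix.diag_apply, reduceC, Matrix.of_apply, Fintype.sum_prod_type]
  calc _ = ∑ e, ∑ x : Basis κ m c w, ∑ γ : Bits c,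
        if x .C = γ then ρ (x, e) (setReg x .C γ, e) else 0 := by
        rw [Finset.sum_comm]
        exact Finset.sum_congr rfl fun e _ => Finset.sum_comm
    _ = ∑ e, ∑ x, ρ (x, e) (x, e) := by
        refine Finset.sum_congr rfl fun e _ => Finset.sum_congr rfl fun x _ => ?_
        rw [Finset.sum_ite_eq, if_pos (Finset.mem_univ _), setReg, Function.update_eq_self]
    _ = _ := Finset.sum_comm

lemma startState_eq (e : E) :
    (startState e : State κ m c w E) =
      Matrix.single ((fun _ => zeros), e) ((fun _ => zeros), e) 1 := by
  ext p q
  simp only [startState, Matrix.of_apply, Matrix.single_apply, eq_comm]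

lemma trace_startState (e : E) : (startState e : State κ m c w E).trace = 1 := by
  rw [startState_eq, Matrix.trace_single_eq_same]

section cnot

variable {r r2 : Reg} (i : Fin (layout κ m c w r)) (i2 : Fin (layout κ m c w r2))

/-- The permutation of basis labels performed by a CNOT. -/
def cnotPerm (x : Basis κ m c w) : Basis κ m c w :=
  setWire x r2 i2 (xor (x r2 i2) (x r i))

lemma cnotPerm_control (h : ¬(r = r2 ∧ (i : ℕ) = i2)) (x : Basis κ m c w) :
    cnotPerm i i2 x r i = x r i := by
  unfold cnotPerm setWire setReg
  by_cases hr : r = r2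
  · subst hr
    rw [Function.update_self, Function.update_of_ne]
    exact fun hi => h ⟨rfl, congrArg Fin.val hi⟩
  · rw [Function.update_of_ne hr]

lemma cnotPerm_target (x : Basis κ m c w) :
    cnotPerm i i2 x r2 i2 = xor (x r2 i2) (x r i) := by
  simp [cnotPerm, setWire, setReg]

lemma cnotPerm_involutive (h : ¬(r = r2 ∧ (i : ℕ) = i2)) :
    Function.Involutive (cnotPerm i i2 : Basis κ m c w → Basis κ m c w) := by
  intro x
  conv_lhs => rw [cnotPerm]
  rw [cnotPerm_control i i2 h, cnotPerm_target]
  simp [cnotPerm, setWire, setReg]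

lemma conjBy_cnotOp_apply (h : ¬(r = r2 ∧ (i : ℕ) = i2)) (ρ : State κ m c w E)
    (p q : Basis κ m c w × E) :
    conjBy (cnotOp r i r2 i2) ρ p q = ρ (cnotPerm i i2 p.1, p.2) (cnotPerm i i2 q.1, q.2) := by
  have hA : ∀ p q, (cnotOp r i r2 i2 ⊗ₖ (1 : Op E)) p q =
      if q = (cnotPerm i i2 p.1, p.2) then 1 else 0 := by
    intro p q
    have : p.1 = cnotPerm i i2 q.1 ↔ q.1 = cnotPerm i i2 p.1 :=
      ⟨fun e => by rw [e, cnotPerm_involutive i i2 h], fun e => by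
        rw [e, cnotPerm_involutive i i2 h]⟩
    simp only [Matrix.kroneckerMap_apply, cnotOp, Matrix.of_apply, Matrix.one_apply, Prod.ext_iff,
      ite_and, mul_ite, mul_one, mul_zero, ← this]
    change (if p.2 = q.2 then if p.1 = cnotPerm i i2 q.1 then (1 : ℂ) else 0 else 0) = _
    by_cases h1 : p.2 = q.2 <;> simp [h1, eq_comm]
  simp only [conjBy, Matrix.mul_apply, Matrix.conjTranspose_apply, hA]
  simp

lemma applyGate_cnot {Ω : Type} (h : ¬(r = r2 ∧ (i : ℕ) = i2)) (ρ : State κ m c w E) :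
    applyGate (.cnot r i r2 i2 : Instr Ω ℕ) ρ = conjBy (cnotOp r i r2 i2) ρ := by
  rw [applyGate, dif_pos ⟨i.2, i2.2, h⟩]

end cnot

/-- A CNOT permutes the basis labels, hence the diagonal of the state: measuring the target
afterwards is measuring the parity of target and control before. -/
lemma outProb_cnot_flag {Ω : Type} (b : Bool) (ρ : State κ m c w E) :
    outProb b (applyGate (.cnot .F 0 .W 0 : Instr Ω ℕ) ρ) =
      ∑ x : Basis κ m c w, ∑ e : E,
        if xor ((x .W : Bits (w + 1)) 0) ((x .F : Bits 1) 0) = b then (ρ (x, e) (x, e)).re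
        else 0 := by
  have h : ¬(Reg.F = Reg.W ∧ ((0 : Fin 1) : ℕ) = (0 : Fin (w + 1))) := by simp
  have hg : applyGate (.cnot .F 0 .W 0 : Instr Ω ℕ) ρ =
      conjBy (cnotOp .F (0 : Fin 1) .W (0 : Fin (w + 1))) ρ :=
    applyGate_cnot (κ := κ) (m := m) (c := c) (w := w) (r := .F) (r2 := .W)
      (0 : Fin 1) (0 : Fin (w + 1)) h ρ
  rw [hg, outProb]
  let π : Basis κ m c w ≃ Basis κ m c w :=
    (cnotPerm_involutive (κ := κ) (m := m) (c := c) (w := w) (r := .F) (r2 := .W)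
      (0 : Fin 1) (0 : Fin (w + 1)) h).toPerm
  rw [← π.sum_comp]
  refine Finset.sum_congr rfl fun x _ => Finset.sum_congr rfl fun e _ => ?_
  rw [conjBy_cnotOp_apply (r := .F) (r2 := .W) _ _ h]
  have h1 : (π x .W : Bits (w + 1)) 0 = xor ((x .W : Bits (w + 1)) 0) ((x .F : Bits 1) 0) :=
    cnotPerm_target (r := .F) (r2 := .W) (0 : Fin 1) (0 : Fin (w + 1)) x
  have h2 : cnotPerm (r := .F) (r2 := .W) (0 : Fin 1) (0 : Fin (w + 1)) (π x) = x :=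
    cnotPerm_involutive (r := .F) (r2 := .W) (0 : Fin 1) (0 : Fin (w + 1)) h x
  rw [h1, h2]

lemma mkBasis_eta (x : Basis κ m c w) : mkBasis (x .K) (x .M) (x .F) (x .C) (x .W) = x := by
  funext r; cases r <;> rfl

lemma mkBasis_eq_zeros (k : Bits κ) (μ : Bits m) (f : Bits 1) (γ : Bits c) (ω : Bits (w + 1)) :
    mkBasis k μ f γ ω = (fun _ => zeros) ↔
      k = zeros ∧ μ = zeros ∧ f = zeros ∧ γ = zeros ∧ ω = zeros := by
  constructor
  · intro h
    exact ⟨congrFun h .K, congrFun h .M, congrFun h .F, congrFun h .C, congrFun h .W⟩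
  · rintro ⟨rfl, rfl, rfl, rfl, rfl⟩
    funext r; cases r <;> rfl

/-- Before any gate the submitted ciphertext is all zero; the registers that are not handed over
carry weight only at the all-zero label. -/
lemma decInput_startState (e : E) (x : Basis κ m c w) :
    decInput (startState e) x x =
      if x .K = zeros ∧ x .W = zeros then Matrix.single (zeros, e) (zeros, e) 1 else 0 := by
  rw [← mkBasis_eta x]
  generalize x .K = k, x .M = μ, x .F = f, x .C = γ, x .W = ω
  ext ⟨a, a2⟩ ⟨b, b2⟩
  simp only [decInput, Matrix.of_apply, startState, setReg_mkBasis_M, setReg_mkBasis_F,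
    setReg_mkBasis_C, mkBasis_K, mkBasis_W, Prod.mk.injEq, mkBasis_eq_zeros]
  rw [Finset.sum_eq_single zeros, Finset.sum_eq_single zeros]
  · by_cases hk : k = zeros <;> by_cases hω : ω = zeros <;>
      simp [hk, hω, Matrix.single_apply, eq_comm]
  · intro f _ hf; simp [hf]
  · simp
  · intro u _ hu; simp [hu]
  · simp

end attacks

lemma sum_single_apply {α β : Type} [Fintype α] [DecidableEq α] [DecidableEq β] (a : α) {e e' : β}
    (h : e = e') :
    ∑ x, (Matrix.single (a, e) (a, e) 1 : Op (α × β)) (x, e') (x, e') = 1 := by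
  simp [Matrix.single_apply, h]

/-- A scheme that never rejects is forged by the adversary that makes no query and submits the
all-zero ciphertext. -/
theorem not_QUF_of_never_rejects {S : Scheme} (hS : ∀ n k, IsChannel (S.Dec n k))
    (hN : ∀ n k Y, S.Dec n k Y none none = 0) (T : Characterization S) : ¬ QUF S T := by
  intro h
  obtain ⟨ε, hε, hle⟩ := h (.write [])
  refine not_negligible_of_one_le (fun n => le_trans ?_ (hle n)) hε
  have hc : (QPT.write [] : QPT EncOnly).circuit n = [] := QPT.circuit_write _ _
  have h1 : forgeWin S (.write []) n = 1 := by
    rw [forgeWin, ← avgKey_const (κ := S.keyLen n) 1]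
    refine congrArg avgKey (funext fun k => ?_)
    -- The circuit also occurs in the type of the states, through its width, so all occurrences are
    -- replaced at once.
    generalize (QPT.write [] : QPT EncOnly).circuit n = l at hc
    subst hc
    set Y : Op (Bits (S.ctLen n)) := Matrix.of fun a b =>
      reduceC (startState () : State 0 (S.ptLen n) (S.ctLen n) (width ([] : List (Instr EncOnly ℕ)))
        Unit) (a, ()) (b, ()) with hY
    have hY1 : Y.trace = 1 := by
      rw [← trace_startState (κ := 0) (m := S.ptLen n) (c := S.ctLen n)
        (w := width ([] : List (Instr EncOnly ℕ))) (), ← trace_reduceC]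
      simp [Matrix.trace, hY, Fintype.sum_prod_type]
    -- Decryption preserves the trace and has no weight at `⊥`, so all weight is on plaintexts.
    have ht := (hS n k).trace Y
    rw [hY1, Matrix.trace, Fintype.sum_option] at ht
    simp only [Matrix.diag_apply, hN, zero_add] at ht
    change ∑ x, (S.Dec n k Y (some x) (some x)).re = 1
    rw [← Complex.re_sum, ht, Complex.one_re]
  have h0 : forgeCheat S T (.write []) n = 0 := by
    rw [forgeCheat, ← avgKey_const (κ := S.keyLen n) 0]
    refine congrArg avgKey (funext fun k => ?_)
    generalize (QPT.write [] : QPT EncOnly).circuit n = l at hc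
    subst hc
    -- Without queries there are no slots, and `cheatProb` is an empty fold with initial value `0`.
    rfl
  rw [h1, h0]; norm_num

/-- A scheme that never rejects is distinguished from the ideal one by the adversary that asks for
the decryption of the all-zero ciphertext and outputs the reject flag. -/
theorem not_QAE_of_never_rejects {S : Scheme} (hS : ∀ n k, IsChannel (S.Dec n k))
    (hN : ∀ n k Y, S.Dec n k Y none none = 0) (T : Characterization S) : ¬ QAE S T := by
  intro h
  -- The `1`s are stack indices, not positions: stack `1` is empty, so both qubits are at position
  -- `0`.
  obtain ⟨ε, hε, hle⟩ := h (.write [.query .dec, .cnot .F 1 .W 1])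
  refine not_negligible_of_one_le (fun n => le_trans ?_ (hle n)) hε
  have hc : (QPT.write [.query .dec, .cnot .F 1 .W 1] : QPT EncDec).circuit n =
      [.query .dec, .cnot .F 0 .W 0] := QPT.circuit_write _ _
  have h0 : qaeReal S (.write [.query .dec, .cnot .F 1 .W 1]) n = 0 := by
    rw [qaeReal, ← avgKey_const (κ := S.keyLen n) 0]
    refine congrArg avgKey (funext fun k => ?_)
    generalize (QPT.write [.query .dec, .cnot .F 1 .W 1] : QPT EncDec).circuit n = l at hc
    subst hc
    change outProb true (applyGate (.cnot .F 0 .W 0 : Instr EncDec ℕ)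
      (decCall (ampl Unit (S.Dec n k)) (startState ()))) = 0
    rw [outProb_cnot_flag]
    refine Finset.sum_eq_zero fun x _ => Finset.sum_eq_zero fun e _ => ite_eq_right_iff.mpr ?_
    intro hx
    have hz : decCall (ampl Unit (S.Dec n k)) (startState ()) (x, e) (x, e) = 0 := by
      rw [decCall_apply, decInput_startState]
      refine ite_eq_right_iff.mpr fun _ => ?_
      -- Outcome `1` needs odd parity of the flag and workspace qubit `0`. With flag `0` the
      -- workspace label is nonzero and has no weight; with flag `1` the entry belongs to `⊥` or to
      -- an unused label, and vanishes.
      obtain hF | hF : x .F = (fun _ => false) ∨ x .F = fun _ => true := by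
        rw [bits_one_eq (x .F)]; cases (x .F : Bits 1) 0 <;> simp
      · rw [hF, Bool.xor_false] at hx
        have hW : ¬(x .K = zeros ∧ x .W = zeros) := fun hW => by
          rw [hW.2] at hx; exact Bool.noConfusion hx
        rw [if_neg hW]
        have h0 : ∀ o o2, ampl Unit (S.Dec n k) 0 (o, e) (o2, e) = 0 := fun o o2 =>
          congrFun (congrFun (hS n k).map_zero o) o2
        exact (flagged_eq_of_flag_false hF).trans (h0 _ _)
      · by_cases hM : x .M = zeros
        · exact (flagged_eq_of_flag_true hF hM).trans (hN n k _)
        · exact flagged_eq_zero hF hM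
    rw [hz, Complex.zero_re]
  have h1 : qaeIdeal S T (.write [.query .dec, .cnot .F 1 .W 1]) n = 1 := by
    rw [qaeIdeal, ← avgKey_const (κ := S.keyLen n) 1]
    refine congrArg avgKey (funext fun k => ?_)
    generalize (QPT.write [.query .dec, .cnot .F 1 .W 1] : QPT EncDec).circuit n = l at hc
    subst hc
    change outProb true (applyGate (.cnot .F 0 .W 0 : Instr EncDec ℕ)
      (decCall ((T.decomp n k).idealDec 0) (startState Fin.elim0))) = 1
    rw [outProb_cnot_flag]
    -- With no slots, the ideal oracle answers `⊥` to everything.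
    have hI : ∀ X o o2 e, (T.decomp n k).idealDec 0 X (o, e) (o2, e) =
        if o = none ∧ o2 = none then ∑ γ, X (γ, e) (γ, e) else 0 := fun X o o2 e =>
      zero_add _
    -- All weight sits at the one label that encodes `⊥`: flag `1`, everything else zero.
    rw [Finset.sum_eq_single (mkBasis zeros zeros (fun _ => true) zeros zeros),
      Fintype.sum_unique]
    · rw [if_pos (by rfl), decCall_apply, decInput_startState, if_pos ⟨rfl, rfl, rfl⟩,
        if_pos ⟨rfl, rfl⟩]
      refine (congrArg Complex.re ((flagged_eq_of_flag_true rfl rfl).trans (hI _ _ _ _))).trans ?_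
      rw [if_pos ⟨rfl, rfl⟩]
      exact congrArg Complex.re (sum_single_apply _ (Subsingleton.elim _ _))
    · intro x _ hx
      refine Finset.sum_eq_zero fun e _ => ite_eq_right_iff.mpr fun hb => ?_
      have hz : decCall ((T.decomp n k).idealDec 0) (startState Fin.elim0) (x, e) (x, e) = 0 := by
        rw [decCall_apply, decInput_startState]
        refine ite_eq_right_iff.mpr fun hC => ?_
        obtain hF | hF : x .F = (fun _ => false) ∨ x .F = fun _ => true := by
          rw [bits_one_eq (x .F)]; cases (x .F : Bits 1) 0 <;> simp
        · exact (flagged_eq_of_flag_false hF).trans (by simp [hI])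
        · by_cases hM : x .M = zeros
          · have hW : ¬(x .K = zeros ∧ x .W = zeros) := fun hW => hx (by
              rw [← mkBasis_eta x, hW.1, hW.2, hM, hF, show x .C = zeros from hC.1])
            exact (flagged_eq_of_flag_true hF hM).trans (by simp [hI, hW])
          · exact flagged_eq_zero hF hM
      rw [hz, Complex.zero_re]
    · simp
  rw [h1, h0]; norm_num

/-! ### Completely positive maps -/

/-- `Φ` is completely positive, in operator-sum form. -/
def IsCP {α β : Type} [Fintype α] (Φ : SuperOp α β) : Prop :=
  ∃ (ι : Type) (_ : Fintype ι) (K : ι → Matrix β α ℂ), ∀ X, Φ X = ∑ i, K i * X * (K i)ᴴ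

section cp

variable {α β γ : Type} [Fintype α] [Fintype β] [Fintype γ]

lemma IsChannel.isCP [DecidableEq α] {Φ : SuperOp α β} (h : IsChannel Φ) : IsCP Φ := by
  obtain ⟨s, K, hK, -⟩ := h
  exact ⟨Fin s, inferInstance, K, hK⟩

lemma IsCP.posSemidef {Φ : SuperOp α β} (h : IsCP Φ) {X : Op α} (hX : X.PosSemidef) :
    (Φ X).PosSemidef := by
  obtain ⟨ι, _, K, hK⟩ := h
  rw [hK]
  exact Matrix.posSemidef_sum _ fun i _ => hX.mul_mul_conjTranspose_same (K i)

lemma IsCP.map_sum {Φ : SuperOp α β} (h : IsCP Φ) {ι : Type} (s : Finset ι) (X : ι → Op α) :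
    Φ (∑ i ∈ s, X i) = ∑ i ∈ s, Φ (X i) := by
  obtain ⟨_, _, K, hK⟩ := h
  simp only [hK, Matrix.mul_sum, Matrix.sum_mul]
  exact Finset.sum_comm

lemma isCP_conj (A : Matrix β α ℂ) : IsCP fun X : Op α => A * X * Aᴴ :=
  ⟨Unit, inferInstance, fun _ => A, fun X => by simp⟩

lemma isCP_id : IsCP fun X : Op α => X := by
  classical
  simpa using isCP_conj (1 : Op α)

lemma IsCP.comp {Ψ : SuperOp β γ} {Φ : SuperOp α β} (hΨ : IsCP Ψ) (hΦ : IsCP Φ) :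
    IsCP fun X => Ψ (Φ X) := by
  obtain ⟨ι, _, K, hK⟩ := hΦ
  obtain ⟨κ, _, L, hL⟩ := hΨ
  refine ⟨κ × ι, inferInstance, fun i => L i.1 * K i.2, fun X => ?_⟩
  simp only [hL, hK, Matrix.mul_sum, Matrix.sum_mul, Fintype.sum_prod_type,
    Matrix.conjTranspose_mul, Matrix.mul_assoc]

lemma IsCP.sum {ι : Type} [Fintype ι] {Φ : ι → SuperOp α β} (h : ∀ i, IsCP (Φ i)) :
    IsCP fun X => ∑ i, Φ i X := by
  choose κ hκ K hK using h
  refine ⟨Σ i, κ i, inferInstance, fun i => K i.1 i.2, fun X => ?_⟩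
  simp only [hK, Fintype.sum_sigma]

lemma IsCP.add {Φ Ψ : SuperOp α β} (hΦ : IsCP Φ) (hΨ : IsCP Ψ) : IsCP fun X => Φ X + Ψ X := by
  have h := IsCP.sum (Φ := fun b : Bool => if b then Φ else Ψ) (by rintro (_ | _) <;> simpa)
  simpa using h

/-- The output entry at `(p, q)` is an entry of the image of a partial trace of a block of the
input that depends on `(p, q)`. -/
lemma IsCP.block {P U : Type} [Fintype U] {Φ : SuperOp α β} (h : IsCP Φ) (f : P → α → U → γ)
    (g : P → β) (good : P → Prop) [DecidablePred good] :
    IsCP fun ρ : Op γ => Matrix.of fun p q =>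
      if good p ∧ good q then Φ (Matrix.of fun a b => ∑ u, ρ (f p a u) (f q b u)) (g p) (g q)
      else 0 := by
  classical
  obtain ⟨ι, _, K, hK⟩ := h
  -- There is one Kraus operator for each Kraus operator of `Φ` and each label `u` of the traced-out
  -- system; its row `p` reads the input at the labels `f p a u`.
  refine ⟨ι × U, inferInstance, fun i => Matrix.of fun p x =>
    if good p then ∑ a, K i.1 (g p) a * if x = f p a i.2 then 1 else 0 else 0, fun ρ => ?_⟩
  ext p q
  simp only [Matrix.sum_apply, Matrix.of_apply, Matrix.mul_apply, Matrix.conjTranspose_apply, hK]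
  by_cases hp : good p
  · by_cases hq : good q
    · simp only [hp, hq, and_self, if_true, Fintype.sum_prod_type, star_sum, star_mul']
      refine Finset.sum_congr rfl fun i _ => ?_
      have h1 : ∀ (u : U) (x : γ),
          ∑ y, (∑ a, K i (g p) a * if y = f p a u then 1 else 0) * ρ y x =
            ∑ a, K i (g p) a * ρ (f p a u) x := by
        intro u x
        simp only [Finset.sum_mul]
        rw [Finset.sum_comm]
        refine Finset.sum_congr rfl fun a _ => ?_
        simp
      have h2 : ∀ (u : U) (F : γ → ℂ),
          ∑ x, F x * ∑ b, star (K i (g q) b) * star (if x = f q b u then (1 : ℂ) else 0) =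
            ∑ b, F (f q b u) * star (K i (g q) b) := by
        intro u F
        simp only [Finset.mul_sum]
        rw [Finset.sum_comm]
        refine Finset.sum_congr rfl fun b _ => ?_
        simp [apply_ite]
      simp only [h1, h2]
      simp only [Finset.mul_sum, Finset.sum_mul]
      calc _ = ∑ b, ∑ u, ∑ a, K i (g p) a * ρ (f p a u) (f q b u) * star (K i (g q) b) :=
            Finset.sum_congr rfl fun b _ => Finset.sum_comm
        _ = _ := Finset.sum_comm
    · simp [hp, hq]
  · simp [hp]

lemma IsCP.ampl {Φ : SuperOp α β} (h : IsCP Φ) (E : Type) [Fintype E] : IsCP (ampl E Φ) := by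
  have := h.block (γ := α × E) (U := Unit) (fun p : β × E => fun a _ => (a, p.2)) Prod.fst
    (fun _ => True)
  simp only [and_self, if_true, Finset.univ_unique, Finset.sum_singleton] at this
  exact this

lemma trace_ampl {Φ : SuperOp α β} (h : ∀ X, (Φ X).trace = X.trace) {E : Type} [Fintype E]
    (X : Op (α × E)) : (ampl E Φ X).trace = X.trace := by
  have h' := fun e => h (Matrix.of fun a b => X (a, e) (b, e))
  simp only [Matrix.trace, Matrix.diag_apply, Matrix.of_apply] at h'
  simp only [Matrix.trace, Matrix.diag_apply, Fintype.sum_prod_type_right, QEnc.ampl,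
    Matrix.of_apply, h']

end cp

/-! ### Positivity and trace preservation of the circuit semantics -/

section circuits

variable {κ m c w : ℕ} {E : Type} [Fintype E] [DecidableEq E]

lemma trace_conjBy {A : Op (Basis κ m c w)} (hA : Aᴴ * A = 1) (ρ : State κ m c w E) :
    (conjBy A ρ).trace = ρ.trace := by
  rw [conjBy, Matrix.trace_mul_comm, ← Matrix.mul_assoc, Matrix.conjTranspose_kronecker,
    ← Matrix.mul_kronecker_mul, hA, Matrix.conjTranspose_one, Matrix.one_mul,
    Matrix.one_kronecker_one, Matrix.one_mul]

section wire

variable (r : Reg) (i : Fin (layout κ m c w r))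

lemma setWire_apply (x : Basis κ m c w) (b : Bool) : setWire x r i b r i = b := by
  simp [setWire, setReg]

lemma setWire_setWire (x : Basis κ m c w) (a b : Bool) :
    setWire (setWire x r i a) r i b = setWire x r i b := by
  simp [setWire, setReg]

lemma setWire_self (x : Basis κ m c w) : setWire x r i (x r i) = x := by
  simp [setWire, setReg]

lemma eq_setWire_iff (x y : Basis κ m c w) :
    y = setWire x r i (y r i) ↔ x = setWire y r i (x r i) := by
  constructor
  · intro h; rw [h, setWire_setWire, setWire_self]
  · intro h; rw [h, setWire_setWire, setWire_self]

lemma sum_setWire {A : Type} [AddCommMonoid A] (x : Basis κ m c w) (f : Basis κ m c w → A) :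
    ∑ y, (if y = setWire x r i (y r i) then f y else 0) = ∑ b, f (setWire x r i b) := by
  calc _ = ∑ y, ∑ b, if y = setWire x r i b then f y else 0 := by
        refine Finset.sum_congr rfl fun y _ => ?_
        rw [Finset.sum_eq_single (y r i)]
        · intro b _ hb
          refine if_neg fun h => hb ?_
          rw [h, setWire_apply]
        · simp
    _ = _ := by
        rw [Finset.sum_comm]
        simp

lemma conjTranspose_wireOp_mul_self {G : Matrix Bool Bool ℂ} (hG : Gᴴ * G = 1) :
    (wireOp r i G : Op (Basis κ m c w))ᴴ * wireOp r i G = 1 := by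
  ext x y
  have h := congrFun (congrFun hG (x r i)) (y r i)
  simp only [Matrix.mul_apply, Matrix.conjTranspose_apply] at h
  simp only [Matrix.mul_apply, Matrix.conjTranspose_apply, wireOp, Matrix.of_apply]
  simp only [apply_ite star, star_zero, ite_mul, zero_mul, eq_setWire_iff r i _ x, sum_setWire]
  simp only [setWire_setWire, setWire_apply, mul_ite, mul_zero]
  by_cases hxy : y = setWire x r i (y r i)
  · simp only [if_pos hxy, h, Matrix.one_apply]
    refine if_congr ⟨fun e => ?_, fun e => by rw [e]⟩ rfl rfl
    rw [hxy, ← e, setWire_self]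
  · rw [Matrix.one_apply_ne]
    · simp [hxy]
    · rintro rfl; exact hxy (setWire_self r i x).symm

lemma isCP_resetWire : IsCP (resetWire r i : State κ m c w E → State κ m c w E) := by
  have h := (isCP_id (α := Unit)).block (γ := Basis κ m c w × E) (U := Bool)
    (fun p : Basis κ m c w × E => fun _ b => (setWire p.1 r i b, p.2)) (fun _ => ())
    (fun p => p.1 r i = false)
  exact h

lemma trace_resetWire (ρ : State κ m c w E) : (resetWire r i ρ).trace = ρ.trace := by
  simp only [Matrix.trace, Matrix.diag_apply, resetWire, Matrix.of_apply, and_self,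
    Fintype.sum_prod_type_right]
  refine Finset.sum_congr rfl fun e _ => ?_
  calc _ = ∑ x : Basis κ m c w, ∑ y, if x = setWire y r i false then ρ (y, e) (y, e) else 0 := by
        refine Finset.sum_congr rfl fun x _ => ?_
        rw [← sum_setWire r i x fun y => ρ (y, e) (y, e)]
        by_cases hx : x r i = false
        · rw [if_pos hx]
          refine Finset.sum_congr rfl fun y _ => ?_
          exact if_congr ((eq_setWire_iff r i x y).trans (by rw [hx])) rfl rfl
        · rw [if_neg hx]
          refine (Finset.sum_eq_zero fun y _ => if_neg fun h => hx ?_).symm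
          rw [h, setWire_apply]
    _ = _ := by rw [Finset.sum_comm]; simp

end wire

lemma hadamardGate_unitary : hadamardGateᴴ * hadamardGate = 1 := by
  have h2 : (Real.sqrt 2 : ℂ) * (Real.sqrt 2 : ℂ) = 2 := by
    rw [← Complex.ofReal_mul, Real.mul_self_sqrt (by norm_num)]; norm_num
  have h0 : (Real.sqrt 2 : ℂ) ≠ 0 := by
    intro h; rw [h] at h2; norm_num at h2
  ext a b
  rw [Matrix.mul_apply, Fintype.sum_bool]
  cases a <;> cases b <;>
    simp [hadamardGate, Complex.conj_ofReal] <;> field_simp <;>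
    rw [pow_two, h2] <;> norm_num

lemma phaseGate_unitary : phaseGateᴴ * phaseGate = 1 := by
  have h : (starRingEnd ℂ) (Complex.exp (Complex.I * Real.pi / 4)) *
      Complex.exp (Complex.I * Real.pi / 4) = 1 := by
    rw [← Complex.exp_conj, ← Complex.exp_add]
    simp [Complex.conj_ofReal, Complex.conj_ofNat, neg_div]
  ext a b
  rw [Matrix.mul_apply, Fintype.sum_bool]
  cases a <;> cases b <;> simp [phaseGate, h]

lemma isCP_applyGate {Ω : Type} (g : Instr Ω ℕ) :
    IsCP (applyGate g : State κ m c w E → State κ m c w E) := by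
  cases g <;> unfold applyGate <;> dsimp only
  all_goals first
    | (split <;> first | exact isCP_conj _ | exact isCP_id | exact isCP_resetWire _ _)
    | exact isCP_id

lemma trace_applyGate {Ω : Type} (g : Instr Ω ℕ) (ρ : State κ m c w E) :
    (applyGate g ρ).trace = ρ.trace := by
  cases g <;> unfold applyGate <;> dsimp only
  · split
    · exact trace_conjBy (conjTranspose_wireOp_mul_self _ _ hadamardGate_unitary) ρ
    · rfl
  · split
    · exact trace_conjBy (conjTranspose_wireOp_mul_self _ _ phaseGate_unitary) ρ
    · rfl
  · split
    · rename_i r i r2 i2 h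
      let π : Basis κ m c w ≃ Basis κ m c w :=
        (cnotPerm_involutive (⟨i, h.1⟩ : Fin (layout κ m c w r)) ⟨i2, h.2.1⟩ h.2.2).toPerm
      simp only [Matrix.trace, Matrix.diag_apply, Fintype.sum_prod_type,
        conjBy_cnotOp_apply (⟨i, h.1⟩ : Fin (layout κ m c w r)) ⟨i2, h.2.1⟩ h.2.2]
      exact π.sum_comp fun x => ∑ e, ρ (x, e) (x, e)
    · rfl
  · split
    · exact trace_resetWire _ _ ρ
    · rfl

lemma posSemidef_startState (e : E) : (startState e : State κ m c w E).PosSemidef := by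
  rw [startState_eq]
  simpa using Matrix.posSemidef_conjTranspose_mul_self
    (Matrix.single ((fun _ => zeros), e) ((fun _ => zeros), e) 1 : State κ m c w E)

lemma posSemidef_reduceC {ρ : State κ m c w E} (hρ : ρ.PosSemidef) :
    (reduceC ρ).PosSemidef := by
  have h : reduceC ρ = ∑ k, ∑ μ, ∑ f, ∑ ω, ρ.submatrix
      (fun p : Bits c × E => (mkBasis k μ f p.1 ω, p.2))
      (fun p : Bits c × E => (mkBasis k μ f p.1 ω, p.2)) := by
    ext p q
    simp only [reduceC, Matrix.of_apply, sum_basis, mkBasis_C, setReg_mkBasis_C,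
      Matrix.sum_apply, Matrix.submatrix_apply]
    refine Finset.sum_congr rfl fun k _ => Finset.sum_congr rfl fun μ _ =>
      Finset.sum_congr rfl fun f _ => ?_
    rw [Finset.sum_comm]
    simp
  rw [h]
  exact Matrix.posSemidef_sum _ fun k _ => Matrix.posSemidef_sum _ fun μ _ =>
    Matrix.posSemidef_sum _ fun f _ => Matrix.posSemidef_sum _ fun ω _ => hρ.submatrix _

variable {E2 : Type} [Fintype E2] [DecidableEq E2]

lemma isCP_encCall {Ψ : SuperOp (Bits m × E) (Bits c × E2)} (h : IsCP Ψ) :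
    IsCP (encCall Ψ : State κ m c w E → State κ m c w E2) :=
  h.block (γ := Basis κ m c w × E) (U := Bits c)
    (fun p : Basis κ m c w × E2 => fun a u => (setReg (setReg p.1 .M a.1) .C u, a.2))
    (fun p => (p.1 .C, p.2)) (fun p => p.1 .M = zeros)

lemma trace_encCall {Ψ : SuperOp (Bits m × E) (Bits c × E2)}
    (h : ∀ X, (Ψ X).trace = X.trace) (ρ : State κ m c w E) :
    (encCall Ψ ρ).trace = ρ.trace := by
  have h' := fun k f ω => h (Matrix.of fun a b => ∑ u : Bits c,
    ρ (mkBasis k a.1 f u ω, a.2) (mkBasis k b.1 f u ω, b.2))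
  simp only [Matrix.trace, Matrix.diag_apply, Matrix.of_apply, Fintype.sum_prod_type] at h'
  simp only [Matrix.trace, Matrix.diag_apply, Fintype.sum_prod_type, encCall, Matrix.of_apply,
    sum_basis, mkBasis_M, mkBasis_C, setReg_mkBasis_M, setReg_mkBasis_C, and_self]
  refine Finset.sum_congr rfl fun k _ => ?_
  rw [Finset.sum_eq_single zeros (by intro b _ hb; simp [hb]) (by simp)]
  simp only [if_true]
  rw [Finset.sum_comm (s := Finset.univ (α := Bits m))]
  refine Finset.sum_congr rfl fun f _ => ?_
  rw [Finset.sum_comm]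
  simp only [h']
  rw [Finset.sum_comm]
  refine Finset.sum_congr rfl fun μ _ => ?_
  rw [Finset.sum_comm (s := Finset.univ (α := Bits c))]
  refine Finset.sum_congr rfl fun ω _ => ?_
  rw [Finset.sum_comm]

/-- Each basis state of plaintexts and `⊥` is encoded by exactly one pair of plaintext string and
flag, and unused pairs contribute `0`. -/
lemma sum_flagged (Y : Op (Option (Bits m))) :
    ∑ μ, ∑ f, flagged Y (μ, f) (μ, f) = Y.trace := by
  rw [Matrix.trace, Fintype.sum_option]
  simp only [sum_bits_one, flagged_eq_of_flag_false, Finset.sum_add_distrib, Matrix.diag_apply]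
  rw [add_comm]
  congr 1
  rw [Finset.sum_eq_single zeros (fun μ _ hμ => flagged_eq_zero rfl hμ) (by simp)]
  exact flagged_eq_of_flag_true rfl rfl

lemma isCP_decCall {Ψ : SuperOp (Bits c × E) (Option (Bits m) × E2)} (h : IsCP Ψ) :
    IsCP (decCall Ψ : State κ m c w E → State κ m c w E2) := by
  -- The condition that both flags agree is not a product of a condition on `p` and one on `q`; it
  -- becomes one after splitting according to the common flag `φ`. The default of `getD` is
  -- harmless, because `isSome` excludes the labels where it would be used.
  have hs := IsCP.sum fun φ : Bits 1 => h.block (γ := Basis κ m c w × E) (U := Bits m × Bits 1)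
    (fun p : Basis κ m c w × E2 => fun a u =>
      (setReg (setReg (setReg p.1 .M u.1) .F u.2) .C a.1, a.2))
    (fun p => ((unflag (p.1 .M) (p.1 .F)).getD none, p.2))
    (fun p => p.1 .C = zeros ∧ p.1 .F = φ ∧ (unflag (p.1 .M) (p.1 .F)).isSome)
  convert hs using 1
  funext ρ
  ext p q
  rw [decCall_apply, Matrix.sum_apply]
  by_cases hF : p.1 .F = q.1 .F
  · rw [Finset.sum_eq_single (p.1 .F)]
    · simp only [Matrix.of_apply, decInput, hF, and_true, true_and, flagged,
        Fintype.sum_prod_type]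
      by_cases hp : p.1 .C = zeros <;> by_cases hq : q.1 .C = zeros <;> simp only [hp, hq] <;>
        cases unflag (p.1 .M) (q.1 .F) <;> cases unflag (q.1 .M) (q.1 .F) <;> simp
    · intro φ _ hφ
      exact if_neg fun h => hφ h.1.2.1.symm
    · simp
  · rw [if_neg fun h => hF h.2.2]
    exact (Finset.sum_eq_zero fun φ _ => if_neg fun h => hF (h.1.2.1.trans h.2.2.1.symm)).symm

lemma reduceC_eq_sum (ρ : State κ m c w E) :
    reduceC ρ = ∑ k, ∑ ω, decInput ρ (mkBasis k zeros zeros zeros ω)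
      (mkBasis k zeros zeros zeros ω) := by
  ext p q
  simp only [reduceC, Matrix.of_apply, sum_basis, mkBasis_C, setReg_mkBasis_C,
    Matrix.sum_apply, decInput, setReg_mkBasis_M, setReg_mkBasis_F]
  refine Finset.sum_congr rfl fun k _ => ?_
  rw [Finset.sum_comm (s := Finset.univ (α := Bits (w + 1)))]
  refine Finset.sum_congr rfl fun μ _ => ?_
  rw [Finset.sum_comm (s := Finset.univ (α := Bits (w + 1)))]
  refine Finset.sum_congr rfl fun f _ => ?_
  rw [Finset.sum_comm]
  simp

/-- The oracle acts on one block for each content of the registers that are not handed over; by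
additivity the blocks combine to `reduceC ρ`. Trace preservation of `Ψ` is not assumed, since the
cheat-detecting oracle loses the weight that is caught. -/
lemma trace_decCall {Ψ : SuperOp (Bits c × E) (Option (Bits m) × E2)} (h : IsCP Ψ)
    (ρ : State κ m c w E) : (decCall Ψ ρ).trace = (Ψ (reduceC ρ)).trace := by
  rw [reduceC_eq_sum, h.map_sum, Matrix.trace_sum]
  simp only [h.map_sum, Matrix.trace_sum]
  simp only [Matrix.trace, Matrix.diag_apply, Fintype.sum_prod_type, decCall_apply, sum_basis,
    mkBasis_M, mkBasis_C, mkBasis_F, and_true, and_self]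
  refine Finset.sum_congr rfl fun k _ => ?_
  have hd : ∀ μ f γ ω, decInput ρ (mkBasis k μ f γ ω) (mkBasis k μ f γ ω) =
      decInput ρ (mkBasis k zeros zeros zeros ω) (mkBasis k zeros zeros zeros ω) := by
    intros
    simp only [decInput, setReg_mkBasis_M, setReg_mkBasis_F, setReg_mkBasis_C]
  let G (ω : Bits (w + 1)) (e : E2) : Op (Option (Bits m)) := Matrix.of fun o o2 =>
    Ψ (decInput ρ (mkBasis k zeros zeros zeros ω) (mkBasis k zeros zeros zeros ω)) (o, e) (o2, e)
  calc _ = ∑ μ, ∑ f, ∑ ω, ∑ e, flagged (G ω e) (μ, f) (μ, f) := by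
        refine Finset.sum_congr rfl fun μ _ => Finset.sum_congr rfl fun f _ => ?_
        refine (Finset.sum_eq_single zeros ?_ ?_).trans ?_
        · intro γ _ hγ
          exact Finset.sum_eq_zero fun ω _ => Finset.sum_eq_zero fun e _ => if_neg hγ
        · intro h0; exact absurd (Finset.mem_univ _) h0
        · refine Finset.sum_congr rfl fun ω _ => Finset.sum_congr rfl fun e _ => ?_
          exact (if_pos rfl).trans (by rw [hd])
    _ = ∑ ω, ∑ e, ∑ μ, ∑ f, flagged (G ω e) (μ, f) (μ, f) := by
        simp only [sum_bits_one, ← Finset.sum_add_distrib]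
        rw [Finset.sum_comm]
        exact Finset.sum_congr rfl fun ω _ => Finset.sum_comm
    _ = _ := by
        refine Finset.sum_congr rfl fun ω _ => ?_
        simp only [sum_flagged]
        exact Finset.sum_comm

end circuits

lemma sum_bits_zero {M : Type} [AddCommMonoid M] (f : Bits 0 → M) (μ : Bits 0) :
    ∑ x, f x = f μ :=
  Finset.sum_eq_single μ (fun b _ hb => absurd (Subsingleton.elim b μ) hb)
    (fun h => absurd (Finset.mem_univ μ) h)

namespace Decomp

variable {m t c : ℕ} {D : Decomp m t c} {Enc : SuperOp (Bits m) (Bits c)}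
  {Dec : SuperOp (Bits c) (Option (Bits m))}

/-! ### The replaced encryption oracle -/

lemma isCP_discardInput {E : Type} [Fintype E] : IsCP (discardInput (m := m) E) := by
  have h := (isCP_id (α := Unit)).block (γ := Bits m × E) (U := Bits m)
    (fun p : Bits m × E => fun _ a => (a, p.2)) (fun _ => ()) (fun p => p.1 = zeros)
  exact h

lemma trace_discardInput {E : Type} [Fintype E] (X : Op (Bits m × E)) :
    (discardInput E X).trace = X.trace := by
  simp only [Matrix.trace, Matrix.diag_apply, discardInput, Matrix.of_apply,
    Fintype.sum_prod_type, and_self]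
  rw [Finset.sum_eq_single zeros (by intro b _ hb; simp [hb]) (by simp)]
  simp only [if_true]
  exact Finset.sum_comm

/-- For fixed randomness `r`, the map relabels its input and conjugates it with a diagonal matrix
that contains `√(p r)` and the ket. This is where nonnegativity of `p` enters. -/
lemma isCP_replaceEnc (hp : ∀ r, 0 ≤ D.p r) (j : ℕ) : IsCP (D.replaceEnc j) := by
  let P := Bits c × Mem m t (j + 1)
  let A (r : Bits t) : Op P := Matrix.diagonal fun p =>
    if (p.2 (Fin.last j)).1 = r then
      (Real.sqrt (D.p r) : ℂ) * D.ket r p.1 (p.2 (Fin.last j)).2.1 else 0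
  have hsub : IsCP fun X : Op (Bits m × Mem m t j) => X.submatrix
      (fun p : P => ((p.2 (Fin.last j)).2.2, Fin.init p.2))
      (fun p : P => ((p.2 (Fin.last j)).2.2, Fin.init p.2)) := by
    have h := (isCP_id (α := Unit)).block (γ := Bits m × Mem m t j) (U := Unit)
      (fun p : P => fun _ _ => ((p.2 (Fin.last j)).2.2, Fin.init p.2)) (fun _ => ())
      (fun _ => True)
    simp only [and_self, if_true, Finset.univ_unique, Finset.sum_singleton] at h
    exact h
  have h := IsCP.sum fun r => (isCP_conj (A r)).comp hsub
  convert h using 1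
  funext X
  ext p q
  rw [Matrix.sum_apply]
  simp only [A, Matrix.diagonal_conjTranspose, Matrix.mul_diagonal, Matrix.diagonal_mul,
    Matrix.submatrix_apply, Pi.star_apply, replaceEnc, Matrix.of_apply]
  by_cases hr : (p.2 (Fin.last j)).1 = (q.2 (Fin.last j)).1
  · rw [if_pos hr, Finset.sum_eq_single (p.2 (Fin.last j)).1]
    · have hs : (Real.sqrt (D.p (p.2 (Fin.last j)).1) : ℂ) *
          Real.sqrt (D.p (p.2 (Fin.last j)).1) = D.p (p.2 (Fin.last j)).1 := by
        rw [← Complex.ofReal_mul, Real.mul_self_sqrt (hp _)]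
      rw [if_pos rfl, if_pos hr.symm, star_mul', ← hs, hr]
      simp only [RCLike.star_def, Complex.conj_ofReal]
      ring
    · intro r _ h1
      rw [if_neg (Ne.symm h1)]; simp
    · simp
  · rw [if_neg hr]
    refine (Finset.sum_eq_zero fun r _ => ?_).symm
    by_cases h1 : (p.2 (Fin.last j)).1 = r
    · rw [if_neg (fun h2 : (q.2 (Fin.last j)).1 = r => hr (h1.trans h2.symm))]; simp
    · rw [if_neg h1]; simp

/-- The ket is the image under the isometry `V` of a unit vector: each label `μ` of the retained
half contributes `2⁻ᵐ`. -/
lemma sum_ket_mul_star (h : D.Characterizes Enc Dec) (r : Bits t) :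
    ∑ γ, ∑ μ, D.ket r γ μ * star (D.ket r γ μ) = 1 := by
  let v (μ : Bits m) : Bits m × Bits t → ℂ := fun x => phiPlus x.1 μ * D.ψ r x.2
  have hv : ∀ γ μ, D.ket r γ μ = (D.V *ᵥ v μ) γ := fun γ μ => by
    simp [ket, Matrix.mulVec, dotProduct, Fintype.sum_prod_type, v]
  have hψ : ∑ s, D.ψ r s * star (D.ψ r s) = 1 := by
    have := h.orthonormal r r
    simpa [dotProduct, mul_comm] using this
  have h1 : ∀ μ, ∑ γ, D.ket r γ μ * star (D.ket r γ μ) = ((2 : ℂ) ^ m)⁻¹ := by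
    intro μ
    calc _ = (D.V *ᵥ v μ) ⬝ᵥ star (D.V *ᵥ v μ) := by simp [dotProduct, hv]
      _ = star (v μ) ⬝ᵥ (D.Vᴴ * D.V) *ᵥ v μ := by
          rw [dotProduct_comm, Matrix.star_mulVec, ← Matrix.dotProduct_mulVec,
            Matrix.mulVec_mulVec]
      _ = ∑ x : Bits m, ∑ s, star (phiPlus x μ * D.ψ r s) * (phiPlus x μ * D.ψ r s) := by
          rw [h.isometry, Matrix.one_mulVec]
          simp [dotProduct, v, Fintype.sum_prod_type]
      _ = ∑ x : Bits m, star (phiPlus x μ) * phiPlus x μ *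
            ∑ s, D.ψ r s * star (D.ψ r s) := by
          simp only [Finset.mul_sum, star_mul']
          refine Finset.sum_congr rfl fun x _ => Finset.sum_congr rfl fun s _ => ?_
          ring
      _ = _ := by
          have hs : (Real.sqrt (2 ^ m) : ℂ) * Real.sqrt (2 ^ m) = 2 ^ m := by
            rw [← Complex.ofReal_mul, Real.mul_self_sqrt (by positivity)]; norm_num
          simp only [hψ, mul_one]
          rw [Finset.sum_eq_single μ (by intro b _ hb; simp [phiPlus, hb]) (by simp)]
          simp only [phiPlus, if_true, RCLike.star_def, map_div₀, map_one, Complex.conj_ofReal]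
          rw [div_mul_div_comm, hs]; simp
  rw [Finset.sum_comm]
  simp only [h1]
  simp

/-- Only the challenge is replaced in Fake, so the case of an empty memory suffices. -/
lemma trace_replaceEnc_zero (h : D.Characterizes Enc Dec) (X : Op (Bits m × Mem m t 0)) :
    (D.replaceEnc 0 X).trace = X.trace := by
  have hp : ∑ r, (D.p r : ℂ) = 1 := by exact_mod_cast h.p_sum
  have he : ∀ e : Mem m t 1, Fin.init e = (default : Mem m t 0) := fun _ => Subsingleton.elim _ _
  simp only [Matrix.trace, Matrix.diag_apply, Fintype.sum_prod_type]
  rw [Finset.sum_comm, ← (Equiv.funUnique (Fin 1) (Bits t × Bits m × Bits m)).symm.sum_comp]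
  simp only [Fintype.sum_prod_type, Fintype.sum_unique]
  calc _ = ∑ r, ∑ μ, ∑ x, ∑ γ, (D.p r : ℂ) * (D.ket r γ μ * star (D.ket r γ μ)) *
        X (x, default) (x, default) := by
        refine Finset.sum_congr rfl fun r _ => Finset.sum_congr rfl fun μ _ =>
          Finset.sum_congr rfl fun x _ => Finset.sum_congr rfl fun γ _ => ?_
        rw [← mul_assoc (D.p r : ℂ)]
        refine (if_pos rfl).trans ?_
        rw [he]
        rfl
    _ = ∑ r, (D.p r : ℂ) * (∑ γ, ∑ μ, D.ket r γ μ * star (D.ket r γ μ)) *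
          ∑ x, X (x, default) (x, default) := by
        refine Finset.sum_congr rfl fun r _ => ?_
        simp only [Finset.mul_sum, Finset.sum_mul]
        rw [Finset.sum_comm]
        refine Finset.sum_congr rfl fun x _ => ?_
        rw [Finset.sum_comm]
    _ = _ := by
        simp only [sum_ket_mul_star h, mul_one, ← Finset.sum_mul, hp, one_mul]
        exact congrArg (fun e => ∑ x, X (x, e) (x, e)) (Subsingleton.elim _ _)

/-! ### The cheat-detecting decryption oracle -/

/-! ### Algebra of the projectors on ciphertext and memory -/

section onCt

variable (D) in
/-- `V (1 ⊗ B) Vᴴ`. -/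
def ctOp (B : Op (Bits t)) : Op (Bits c) := D.V * onTag (m := m) B * D.Vᴴ

lemma ctOp_mul_ctOp (h : D.Characterizes Enc Dec) (A B : Op (Bits t)) :
    D.ctOp A * D.ctOp B = D.ctOp (A * B) := by
  calc D.ctOp A * D.ctOp B =
        D.V * (onTag (m := m) A * (D.Vᴴ * D.V) * onTag (m := m) B) * D.Vᴴ := by
        simp only [ctOp, Matrix.mul_assoc]
    _ = _ := by
        rw [h.isometry, Matrix.mul_one, onTag, onTag, ← Matrix.mul_kronecker_mul,
          Matrix.one_mul]
        rfl

lemma conjTranspose_ctOp (B : Op (Bits t)) : (D.ctOp B)ᴴ = D.ctOp Bᴴ := by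
  simp [ctOp, onTag, Matrix.conjTranspose_mul, Matrix.conjTranspose_kronecker, Matrix.mul_assoc]

lemma onTag_one_sub (B : Op (Bits t)) : onTag (m := m) (1 - B) = 1 - onTag B := by
  rw [onTag, onTag, sub_eq_add_neg, Matrix.kronecker_add, Matrix.one_kronecker_one,
    sub_eq_add_neg]
  congr 1
  ext; simp

lemma ctOp_one_sub (h : D.Characterizes Enc Dec) (B : Op (Bits t)) :
    D.ctOp (1 - B) = 1 - D.ctOp B := by
  rw [ctOp, onTag_one_sub, Matrix.mul_sub, Matrix.sub_mul, Matrix.mul_one, h.coisometry]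
  rfl

variable {j : ℕ}

lemma conjTranspose_onCt {B : Op (Bits t)} (hB : Bᴴ = B) :
    (D.onCt B : Op (Bits c × Mem m t j))ᴴ = D.onCt B := by
  change (D.ctOp B ⊗ₖ 1)ᴴ = D.ctOp B ⊗ₖ 1
  rw [Matrix.conjTranspose_kronecker, conjTranspose_ctOp, hB, Matrix.conjTranspose_one]

lemma onCt_mul_self (h : D.Characterizes Enc Dec) {B : Op (Bits t)} (hB : B * B = B) :
    (D.onCt B : Op (Bits c × Mem m t j)) * D.onCt B = D.onCt B := by
  change D.ctOp B ⊗ₖ 1 * D.ctOp B ⊗ₖ 1 = D.ctOp B ⊗ₖ 1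
  rw [← Matrix.mul_kronecker_mul, ctOp_mul_ctOp h, hB, Matrix.one_mul]

lemma onCt_one_sub (h : D.Characterizes Enc Dec) (B : Op (Bits t)) :
    (D.onCt (1 - B) : Op (Bits c × Mem m t j)) = 1 - D.onCt B := by
  change D.ctOp (1 - B) ⊗ₖ 1 = 1 - D.ctOp B ⊗ₖ 1
  rw [ctOp_one_sub h, sub_eq_add_neg, Matrix.add_kronecker, Matrix.one_kronecker_one,
    sub_eq_add_neg]
  congr 1
  ext; simp

lemma tagProj_apply (i : Fin j) (p q : Bits c × Mem m t j) :
    D.tagProj i p q = if p.2 = q.2 then D.ctOp (D.tagPure (p.2 i).1) p.1 q.1 else 0 := rfl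

lemma conjTranspose_tagProj (i : Fin j) : (D.tagProj i)ᴴ = D.tagProj i := by
  ext p q
  rw [Matrix.conjTranspose_apply, tagProj_apply, tagProj_apply]
  by_cases h : p.2 = q.2
  · rw [if_pos h, if_pos h.symm, ← Matrix.conjTranspose_apply, conjTranspose_ctOp,
      conjTranspose_tagPure, h]
  · rw [if_neg h, if_neg (Ne.symm h), star_zero]

lemma tagProj_mul_self (h : D.Characterizes Enc Dec) (i : Fin j) :
    D.tagProj i * D.tagProj i = D.tagProj i := by
  ext p q
  rw [Matrix.mul_apply, Fintype.sum_prod_type_right, tagProj_apply]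
  simp only [tagProj_apply]
  rw [Finset.sum_eq_single p.2 (by intro e _ he; simp [he.symm]) (by simp)]
  by_cases hpq : p.2 = q.2
  · simp only [if_true, if_pos hpq, ← Matrix.mul_apply]
    rw [ctOp_mul_ctOp h, tagPure_mul_tagPure h, if_pos rfl]
  · simp [hpq]

lemma conjTranspose_matchProj (i : Fin j) : (D.matchProj i)ᴴ = D.matchProj i := by
  ext p q
  simp only [Matrix.conjTranspose_apply, matchProj, Matrix.of_apply]
  by_cases hpq : (p.2 i).1 = (q.2 i).1 ∧ (p.2 i).2.2 = (q.2 i).2.2 ∧ ∀ l, l ≠ i → p.2 l = q.2 l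
  · rw [if_pos hpq, if_pos ⟨hpq.1.symm, hpq.2.1.symm, fun l hl => (hpq.2.2 l hl).symm⟩,
      star_mul', star_star, hpq.1, mul_comm]
  · rw [if_neg hpq, if_neg fun hqp =>
      hpq ⟨hqp.1.symm, hqp.2.1.symm, fun l hl => (hqp.2.2 l hl).symm⟩, star_zero]

/-- For plaintexts of length zero the test of the tag is the whole test. -/
lemma matchProj_eq_tagProj (hm : m = 0) (i : Fin j) : D.matchProj i = D.tagProj i := by
  subst hm
  have hket : ∀ r γ μ, D.ket r γ μ = ∑ s, D.V γ (μ, s) * D.ψ r s := by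
    intro r γ μ
    -- The maximally entangled state of two trivial registers is the scalar `1`, so the ket is just
    -- `V ψ_r`.
    have hφ : ∀ x y : Bits 0, phiPlus x y = 1 := fun x y => by
      rw [phiPlus, if_pos (Subsingleton.elim _ _)]; simp
    simp only [ket, hφ, sum_bits_zero _ μ, one_mul]
  ext ⟨γ, e⟩ ⟨γ', e'⟩
  rw [tagProj_apply]
  simp only [matchProj, Matrix.of_apply]
  by_cases hpq : e = e'
  · subst hpq
    rw [if_pos rfl, if_pos ⟨rfl, rfl, fun l _ => rfl⟩, hket, hket]
    generalize (e i).1 = r, (e i).2.1 = μ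
    simp only [ctOp, Matrix.mul_apply, Fintype.sum_prod_type, sum_bits_zero _ μ,
      Matrix.conjTranspose_apply, onTag, Matrix.kroneckerMap_apply, tagPure,
      Matrix.vecMulVec_apply, Matrix.one_apply_eq, one_mul,
      star_sum, star_mul', Finset.sum_mul, Finset.mul_sum, Pi.star_apply]
    refine Finset.sum_congr rfl fun x _ => Finset.sum_congr rfl fun y _ => ?_
    ring
  · rw [if_neg hpq, if_neg]
    rintro ⟨h1, -, h3⟩
    refine hpq (funext fun l => ?_)
    by_cases hl : l = i
    · subst hl
      exact Prod.ext h1 (Subsingleton.elim _ _)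
    · exact h3 l hl

end onCt

/-! ### Conservation of probability by the cheat-detecting oracle -/

section watchDec

variable {j : ℕ}

lemma trace_compl_add_trace {α : Type} [Fintype α] [DecidableEq α] {Q : Op α} (hQ : Q * Q = Q)
    (X : Op α) : ((1 - Q) * X * (1 - Q)).trace + (Q * X * Q).trace = X.trace := by
  have h1 : ((1 - Q) * X * (1 - Q)).trace = ((1 - Q) * X).trace := by
    rw [Matrix.trace_mul_comm, ← Matrix.mul_assoc]
    congr 2
    rw [Matrix.sub_mul, Matrix.one_mul, Matrix.mul_sub, Matrix.mul_one, hQ, sub_self, sub_zero]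
  have h2 : (Q * X * Q).trace = (Q * X).trace := by
    rw [Matrix.trace_mul_comm, ← Matrix.mul_assoc, hQ]
  rw [h1, h2, ← Matrix.trace_add, ← Matrix.add_mul, sub_add_cancel, Matrix.one_mul]

lemma isCP_miss (i : Fin j) : IsCP (D.miss i) := by
  have h1 : (1 - D.tagProj i)ᴴ = 1 - D.tagProj i := by
    rw [Matrix.conjTranspose_sub, conjTranspose_tagProj, Matrix.conjTranspose_one]
  have h2 : (D.tagProj i - D.matchProj i)ᴴ = D.tagProj i - D.matchProj i := by
    rw [Matrix.conjTranspose_sub, conjTranspose_tagProj, conjTranspose_matchProj]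
  have h := (isCP_conj (1 - D.tagProj i)).add (isCP_conj (D.tagProj i - D.matchProj i))
  rw [h1, h2] at h
  exact h

/-- For length zero the second branch of `miss` vanishes, and what remains is the two-outcome
measurement of `tagProj`. -/
lemma trace_miss_add_matchProb (h : D.Characterizes Enc Dec) (hm : m = 0) (i : Fin j)
    (X : Op (Bits c × Mem m t j)) : (D.miss i X).trace.re + D.matchProb i X = X.trace.re := by
  rw [miss, matchProb, matchProj_eq_tagProj hm, sub_self, Matrix.zero_mul, Matrix.zero_mul,
    add_zero, ← Complex.add_re]
  exact congrArg Complex.re (trace_compl_add_trace (tagProj_mul_self h i) X)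

lemma matchProb_nonneg (i : Fin j) {X : Op (Bits c × Mem m t j)} (hX : X.PosSemidef) :
    0 ≤ D.matchProb i X := by
  have h := hX.mul_mul_conjTranspose_same (D.matchProj i)
  rw [conjTranspose_matchProj] at h
  exact (Complex.nonneg_iff.mp h.trace_nonneg).1

lemma isCP_embed : IsCP (embed (m := m)) := by
  refine ⟨Unit, inferInstance, fun _ => Matrix.of fun o x => if o = some x then 1 else 0,
    fun X => ?_⟩
  ext (_ | x) (_ | y) <;>
    simp [embed, Matrix.mul_apply, Matrix.conjTranspose_apply, apply_ite]

lemma trace_embed (X : Op (Bits m)) : (embed X).trace = X.trace := by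
  simp [Matrix.trace, Fintype.sum_option, embed]

lemma isCP_traceTag : IsCP (traceTag (m := m) (t := t)) := by
  have h := (isCP_id (α := Unit)).block (γ := Bits m × Bits t) (U := Bits t)
    (fun p : Bits m => fun _ s => (p, s)) (fun _ => ()) (fun _ => True)
  simp only [and_self, if_true] at h
  exact h

lemma trace_traceTag (X : Op (Bits m × Bits t)) : (traceTag X).trace = X.trace := by
  simp [Matrix.trace, Fintype.sum_prod_type, traceTag]

lemma isCP_undo : IsCP D.undo := by
  have h := isCP_conj D.Vᴴ
  rw [Matrix.conjTranspose_conjTranspose] at h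
  exact h

lemma trace_undo (h : D.Characterizes Enc Dec) (Y : Op (Bits c)) :
    (D.undo Y).trace = Y.trace := by
  rw [undo, Matrix.trace_mul_comm, ← Matrix.mul_assoc, h.coisometry, Matrix.one_mul]

lemma isCP_watchDec (h : D.Characterizes Enc Dec) : IsCP D.watchDec := by
  have h1 : IsCP fun X : Op (Bits c × Mem m t 1) => D.onCt D.supp * X * D.onCt D.supp := by
    have := isCP_conj (D.onCt D.supp : Op (Bits c × Mem m t 1))
    rwa [conjTranspose_onCt conjTranspose_supp] at this
  have h2 : IsCP fun X : Op (Bits c × Mem m t 1) =>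
      D.onCt (1 - D.supp) * X * D.onCt (1 - D.supp) := by
    have := isCP_conj (D.onCt (1 - D.supp) : Op (Bits c × Mem m t 1))
    rwa [conjTranspose_onCt (by rw [Matrix.conjTranspose_sub, conjTranspose_supp,
      Matrix.conjTranspose_one])] at this
  exact (((isCP_embed.comp (isCP_traceTag.comp isCP_undo)).ampl _).comp
    ((isCP_miss 0).comp h1)).add (((h.channel.isCP.comp isCP_undo).ampl _).comp h2)

/-- Everything after the two measurements preserves the trace, so the weight missing from the
response is exactly the detected weight. -/
lemma trace_watchDec_add_detectProb (h : D.Characterizes Enc Dec) (hm : m = 0)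
    (X : Op (Bits c × Mem m t 1)) :
    (D.watchDec X).trace.re + D.detectProb X = X.trace.re := by
  have h1 : ∀ Z : Op (Bits c × Mem m t 1),
      (ampl _ (fun Y => embed (traceTag (D.undo Y))) Z).trace = Z.trace :=
    trace_ampl fun Y => by rw [trace_embed, trace_traceTag, trace_undo h]
  have h2 : ∀ Z : Op (Bits c × Mem m t 1),
      (ampl _ (fun Y => D.Dhat (D.undo Y)) Z).trace = Z.trace :=
    trace_ampl fun Y => by rw [h.channel.trace, trace_undo h]
  rw [watchDec, Matrix.trace_add, h1, h2, detectProb, Complex.add_re, add_right_comm,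
    trace_miss_add_matchProb h hm, onCt_one_sub h, ← Complex.add_re, add_comm,
    trace_compl_add_trace (onCt_mul_self h (supp_mul_supp h))]

lemma detectProb_nonneg {X : Op (Bits c × Mem m t 1)} (hX : X.PosSemidef) :
    0 ≤ D.detectProb X := by
  have h := hX.mul_mul_conjTranspose_same (D.onCt D.supp)
  rw [conjTranspose_onCt conjTranspose_supp] at h
  exact matchProb_nonneg 0 h

end watchDec

end Decomp

/-! ### Schemes with plaintexts of length zero -/

section games

variable {S : Scheme} {T : Characterization S}

lemma isCP_realStep (hE : ∀ n k, IsChannel (S.Enc n k)) (hD : ∀ n k, IsChannel (S.Dec n k)) (n : ℕ)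
    (k : Bits (S.keyLen n)) {w : ℕ} {E : Type} [Fintype E] [DecidableEq E]
    (g : Instr EncDec ℕ) :
    IsCP fun ρ : State 0 (S.ptLen n) (S.ctLen n) w E => realStep S n k ρ g := by
  rcases g with _ | _ | _ | _ | ⟨_ | _⟩
  case query.enc => exact isCP_encCall ((hE n k).isCP.ampl E)
  case query.dec => exact isCP_decCall ((hD n k).isCP.ampl E)
  case hadamard r i => exact isCP_applyGate (Ω := EncDec) (.hadamard r i)
  case phaseT r i => exact isCP_applyGate (Ω := EncDec) (.phaseT r i)
  case cnot r i r2 i2 => exact isCP_applyGate (Ω := EncDec) (.cnot r i r2 i2)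
  case reset r i => exact isCP_applyGate (Ω := EncDec) (.reset r i)

lemma trace_realStep (hE : ∀ n k, IsChannel (S.Enc n k)) (hD : ∀ n k, IsChannel (S.Dec n k)) (n : ℕ)
    (k : Bits (S.keyLen n)) {w : ℕ} {E : Type} [Fintype E] [DecidableEq E]
    (ρ : State 0 (S.ptLen n) (S.ctLen n) w E) (g : Instr EncDec ℕ) :
    (realStep S n k ρ g).trace = ρ.trace := by
  rcases g with _ | _ | _ | _ | ⟨_ | _⟩
  case query.enc => exact trace_encCall (trace_ampl (hE n k).trace) ρ
  case query.dec =>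
    exact (trace_decCall ((hD n k).isCP.ampl E) ρ).trans
      ((trace_ampl (hD n k).trace _).trans (trace_reduceC ρ))
  case hadamard r i => exact trace_applyGate (Ω := EncDec) (.hadamard r i) ρ
  case phaseT r i => exact trace_applyGate (Ω := EncDec) (.phaseT r i) ρ
  case cnot r i r2 i2 => exact trace_applyGate (Ω := EncDec) (.cnot r i r2 i2) ρ
  case reset r i => exact trace_applyGate (Ω := EncDec) (.reset r i) ρ

/-- Runs of the real game preserve positivity and trace. -/
lemma foldl_realStep (hE : ∀ n k, IsChannel (S.Enc n k)) (hD : ∀ n k, IsChannel (S.Dec n k)) (n : ℕ)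
    (k : Bits (S.keyLen n)) {w : ℕ} {E : Type} [Fintype E] [DecidableEq E]
    (l : List (Instr EncDec ℕ)) (ρ : State 0 (S.ptLen n) (S.ctLen n) w E) :
    (ρ.PosSemidef → (l.foldl (realStep S n k) ρ).PosSemidef) ∧
      (l.foldl (realStep S n k) ρ).trace = ρ.trace := by
  induction l generalizing ρ with
  | nil => exact ⟨id, rfl⟩
  | cons g l ih =>
    rw [List.foldl_cons]
    exact ⟨fun h => (ih _).1 ((isCP_realStep hE hD n k g).posSemidef h),
      (ih _).2.trans (trace_realStep hE hD n k ρ g)⟩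

/-- The invariant of the second phase of the fake game. -/
def FakeInvariant {κ m c w : ℕ} {E : Type} [Fintype E] (s : State κ m c w E × ℝ) : Prop :=
  s.1.PosSemidef ∧ 0 ≤ s.2 ∧ s.1.trace.re + s.2 = 1

/-- A decryption query only moves weight from the state to the record of being caught, by an amount
that is nonnegative because the state is positive; other instructions preserve both. -/
lemma FakeInvariant.fakeStep (hE : ∀ n k, IsChannel (S.Enc n k)) (hT : T.Valid) {n : ℕ}
    (hm : S.ptLen n = 0) (k : Bits (S.keyLen n)) {w : ℕ}
    {s : State 0 (S.ptLen n) (S.ctLen n) w (Mem (S.ptLen n) (T.tagLen n) 1) × ℝ}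
    (hs : FakeInvariant s) (g : Instr EncDec ℕ) : FakeInvariant (fakeStep S T n k s g) := by
  obtain ⟨h1, h2, h3⟩ := hs
  have hg : ∀ g : Instr EncDec ℕ, FakeInvariant (applyGate g s.1, s.2) := fun g =>
    ⟨(isCP_applyGate g).posSemidef h1, h2, by rw [← h3, trace_applyGate]⟩
  rcases g with _ | _ | _ | _ | ⟨_ | _⟩
  case query.enc =>
    refine ⟨(isCP_encCall ((hE n k).isCP.ampl _)).posSemidef h1, h2, ?_⟩
    have ht : (encCall (ampl _ (S.Enc n k)) s.1).trace = s.1.trace :=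
      trace_encCall (trace_ampl (hE n k).trace) s.1
    change (encCall (ampl _ (S.Enc n k)) s.1).trace.re + s.2 = 1
    rw [ht, h3]
  case query.dec =>
    have hw := Decomp.isCP_watchDec (hT n k)
    refine ⟨(isCP_decCall hw).posSemidef h1,
      add_nonneg h2 (Decomp.detectProb_nonneg (posSemidef_reduceC h1)), ?_⟩
    have ht : (decCall (T.decomp n k).watchDec s.1).trace.re +
        (T.decomp n k).detectProb (reduceC s.1) = s.1.trace.re := by
      rw [trace_decCall hw, Decomp.trace_watchDec_add_detectProb (hT n k) hm, trace_reduceC]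
    change (decCall (T.decomp n k).watchDec s.1).trace.re +
      (s.2 + (T.decomp n k).detectProb (reduceC s.1)) = 1
    linarith
  case hadamard r i => exact hg (.hadamard r i)
  case phaseT r i => exact hg (.phaseT r i)
  case cnot r i r2 i2 => exact hg (.cnot r i r2 i2)
  case reset r i => exact hg (.reset r i)

lemma outProb_add (κ m c w : ℕ) {E : Type} [Fintype E] (ρ : State κ m c w E) :
    outProb false ρ + outProb true ρ = ρ.trace.re := by
  simp only [outProb, ← Finset.sum_add_distrib, Matrix.trace, Matrix.diag_apply, Complex.re_sum,
    Fintype.sum_prod_type]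
  refine Finset.sum_congr rfl fun x _ => Finset.sum_congr rfl fun e _ => ?_
  cases (x .W : Bits (w + 1)) 0 <;> simp

/-- On a one-dimensional space every operator is a multiple of the maximally mixed state. -/
lemma encMixed_eq_self {m c : ℕ} (hm : m = 0) {Φ : SuperOp (Bits m) (Bits c)} (h : IsChannel Φ) :
    encMixed Φ = Φ := by
  subst hm
  funext X
  rw [encMixed, ← h.map_smul]
  congr 1
  ext x y
  rw [Subsingleton.elim y x, Matrix.trace, sum_bits_zero _ x]
  simp

/-- If there is only one plaintext, then there is nothing to distinguish. -/
theorem QINDCCA2_of_ptLen_eq_zero (hE : ∀ n k, IsChannel (S.Enc n k))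
    (hD : ∀ n k, IsChannel (S.Dec n k)) (hT : T.Valid) (hm : ∀ n, S.ptLen n = 0) :
    QINDCCA2 S T := by
  intro A₁ A₂
  refine ⟨fun _ => 0, negligible_zero, fun n => sub_nonpos.mpr ?_⟩
  rw [testWin_eq, fakeCheat_eq]
  -- The inequality holds for each key separately.
  refine div_le_div_of_nonneg_right (Finset.sum_le_sum fun k _ => ?_) (by positivity)
  generalize A₁.circuit n = l₁, A₂.circuit n = l₂, width2 A₁ A₂ n = w
  -- Both challenge bits lead to the same final state, so the two complementary outcome
  -- probabilities add up to its trace `1`.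
  have h1 : testWinOf (w := w) (realStep S n k) (S.Enc n k) l₁ l₂ = 1 / 2 := by
    simp only [testWinOf, encMixed_eq_self (hm n) (hE n k), outProb_add,
      (foldl_realStep hE hD n k _ _).2, trace_encCall (trace_ampl (hE n k).trace),
      trace_startState, Complex.one_re]
  have h2 : 1 / 2 ≤ fakeCheatOf (w := w) (T.decomp n k) (realStep S n k) (fakeStep S T n k)
      l₁ l₂ := by
    set ρ := l₁.foldl (realStep S n k) (startState Fin.elim0 :
      State 0 (S.ptLen n) (S.ctLen n) w (Mem (S.ptLen n) (T.tagLen n) 0)) with hρ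
    have hf := foldl_realStep hE hD n k l₁ (startState Fin.elim0 :
      State 0 (S.ptLen n) (S.ctLen n) w (Mem (S.ptLen n) (T.tagLen n) 0))
    rw [trace_startState, ← hρ] at hf
    have h0 : FakeInvariant ((encCall (fun X => (T.decomp n k).replaceEnc 0 (discardInput _ X)) ρ :
        State 0 (S.ptLen n) (S.ctLen n) w (Mem (S.ptLen n) (T.tagLen n) 1)), (0 : ℝ)) := by
      refine ⟨(isCP_encCall ((Decomp.isCP_replaceEnc (hT n k).p_nonneg 0).comp
        Decomp.isCP_discardInput)).posSemidef (hf.1 (posSemidef_startState _)), le_rfl, ?_⟩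
      rw [add_zero]
      dsimp only
      rw [trace_encCall fun X => (Decomp.trace_replaceEnc_zero (hT n k) _).trans
        (Decomp.trace_discardInput X), hf.2, Complex.one_re]
    have hinv : ∀ (l : List (Instr EncDec ℕ))
        (s : State 0 (S.ptLen n) (S.ctLen n) w (Mem (S.ptLen n) (T.tagLen n) 1) × ℝ),
        FakeInvariant s → FakeInvariant (l.foldl (fakeStep S T n k) s) := by
      intro l
      induction l with
      | nil => exact fun s hs => hs
      | cons g l ih => exact fun s hs => ih _ (hs.fakeStep hE hT (hm n) k g)
    obtain ⟨-, h4, h5⟩ := hinv l₂ _ h0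
    -- With caught probability `a` and remaining weight `1 - a`, the value is `a + (1 - a) / 2`,
    -- which is at least `1 / 2`.
    rw [fakeCheatOf]
    linarith
  rw [h1]
  exact h2

end games

/-! ### A scheme that sends its key and accepts every ciphertext -/

/-- The channel that discards its input and prepares a basis state. -/
def prepare {α β : Type} [Fintype α] [DecidableEq β] (b : β) : SuperOp α β :=
  fun X => X.trace • Matrix.single b b 1

lemma isChannel_prepare {α β : Type} [Fintype α] [DecidableEq α] [Fintype β] [DecidableEq β]
    (b : β) : IsChannel (prepare b : SuperOp α β) := by
  refine .of_kraus (fun a : α => Matrix.single b a (1 : ℂ)) (fun X => ?_) ?_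
  · simp only [Matrix.conjTranspose_single, Matrix.single_mul_mul_single, prepare, Matrix.trace,
      Finset.sum_smul, Matrix.smul_single, star_one, mul_one, one_mul, smul_eq_mul,
      Matrix.diag_apply]
  · simp only [Matrix.conjTranspose_single, Matrix.single_mul_single_same, star_one, mul_one]
    ext x y
    simp [Matrix.sum_apply, Matrix.single_apply, Matrix.one_apply, ite_and]

/-- Plaintexts of length zero; the encryption is the key, and decryption accepts everything: this is
the authentication of the empty message by the key, made never to reject. -/
def keyScheme : Scheme where
  keyLen := fun n => n
  ptLen := fun _ => 0
  ctLen := fun n => n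
  Enc := fun _ k => prepare k
  Dec := fun _ _ => prepare (some zeros)

/-- The whole ciphertext is the tag, and the tag state is the key. -/
def keyDecomp {n : ℕ} (k : Bits n) : Decomp 0 n n where
  V := Matrix.of fun γ x => if γ = x.2 then 1 else 0
  p := fun r => if r = k then 1 else 0
  ψ := fun r => Pi.single r 1
  Dhat := prepare (some zeros)

def keyCharacterization : Characterization keyScheme where
  tagLen := fun n => n
  decomp := fun _ k => keyDecomp k

/-! ### The characterization of the key scheme -/

section keyDecomp

variable {n : ℕ} (k : Bits n)

lemma tagPure_keyDecomp (r : Bits n) : (keyDecomp k).tagPure r = Matrix.single r r 1 := by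
  ext x y
  simp [Decomp.tagPure, keyDecomp, Matrix.vecMulVec_apply, Matrix.single_apply, Pi.single_apply,
    ite_and, eq_comm]
  split_ifs <;> rfl

lemma supp_keyDecomp : (keyDecomp k).supp = Matrix.single k k 1 := by
  rw [Decomp.supp, Finset.sum_eq_single k]
  · rw [tagPure_keyDecomp]; simp [keyDecomp]
  · intro r _ hr; simp [keyDecomp, hr]
  · simp

lemma σ_keyDecomp : (keyDecomp k).σ = Matrix.single k k 1 := by
  rw [Decomp.σ, Finset.sum_eq_single k]
  · rw [tagPure_keyDecomp]; simp [keyDecomp]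
  · intro r _ hr; simp [keyDecomp, hr]
  · simp

lemma embed_eq_prepare (X : Op (Bits 0)) : embed X = prepare (some zeros) X := by
  ext (_ | x) (_ | y)
  · simp [embed, prepare]
  · simp [embed, prepare]
  · simp [embed, prepare]
  · rw [Subsingleton.elim x zeros, Subsingleton.elim y zeros]
    simp only [embed, prepare, Matrix.trace, sum_bits_zero _ zeros, Matrix.of_apply,
      Matrix.smul_apply, Matrix.single_apply_same, smul_eq_mul, mul_one, Matrix.diag_apply]

/-- Here `V` merely drops the trivial plaintext register. Both branches of decryption prepare the
same state, so only their weights matter, and these add up to `tr Y`. -/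
lemma characterizes_keyDecomp :
    (keyDecomp k).Characterizes (prepare k) (prepare (some zeros)) := by
  have hVV : (keyDecomp k).Vᴴ * (keyDecomp k).V = 1 := by
    ext ⟨μ, s⟩ ⟨ν, s'⟩
    simp [keyDecomp, Matrix.mul_apply, Matrix.one_apply, Subsingleton.elim μ ν, apply_ite]
    by_cases h : s = s' <;> simp [h, eq_comm]
  have hVV' : (keyDecomp k).V * (keyDecomp k).Vᴴ = 1 := by
    ext γ γ'
    simp [keyDecomp, Matrix.mul_apply, Matrix.one_apply, Fintype.sum_prod_type, apply_ite]
  refine ⟨hVV, hVV', fun r => ?_, ?_, fun r s => ?_, isChannel_prepare _, fun X => ?_,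
    fun Y => ?_⟩
  · simp only [keyDecomp]; split_ifs <;> norm_num
  · simp [keyDecomp]
  · simp [keyDecomp, Pi.single_apply, eq_comm]
  · rw [σ_keyDecomp]
    ext γ γ'
    simp only [keyDecomp, prepare, Matrix.mul_apply, Fintype.sum_prod_type, sum_bits_zero _ zeros,
      Matrix.single_apply, Matrix.trace, Matrix.smul_apply, Matrix.of_apply, Matrix.diag_apply,
      Matrix.conjTranspose_apply, Matrix.kroneckerMap_apply, smul_eq_mul, apply_ite star,
      star_one, star_zero, ite_mul, one_mul, zero_mul, mul_ite, mul_one, mul_zero,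
      Finset.sum_ite_eq, Finset.mem_univ, if_true]
    rw [Finset.sum_eq_single k (by intro b _ hb; simp [hb.symm]) (by simp)]
    by_cases h : k = γ
    · simp [h]
    · simp [h, Ne.symm h]
  · set Q : Op (Bits 0 × Bits n) := Decomp.onTag (keyDecomp k).supp with hQ
    have hQQ : Q * Q = Q := by
      rw [hQ, Decomp.onTag, ← Matrix.mul_kronecker_mul, supp_keyDecomp,
        Matrix.single_mul_single_same, Matrix.one_mul, one_mul]
    have hQ' : Decomp.onTag (1 - (keyDecomp k).supp) = 1 - Q := by
      rw [hQ, Decomp.onTag_one_sub]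
    have hu : ((keyDecomp k).undo Y).trace = Y.trace := by
      rw [Decomp.undo, Matrix.trace_mul_comm, ← Matrix.mul_assoc, hVV', Matrix.one_mul]
    rw [hQ', embed_eq_prepare]
    change Y.trace • _ = Matrix.trace (Decomp.traceTag _) • _ + Matrix.trace _ • _
    rw [Decomp.trace_traceTag, ← add_smul, add_comm, Decomp.trace_compl_add_trace hQQ, hu]

end keyDecomp

/-! ### The circuits of the key scheme -/

section circuits

variable {n w : ℕ} (k : Bits n)

lemma conjBy_cnotOp_single {κ m c w : ℕ} {E : Type} [Fintype E] [DecidableEq E] {r r2 : Reg}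
    (i : Fin (layout κ m c w r)) (i2 : Fin (layout κ m c w r2)) (h : ¬(r = r2 ∧ (i : ℕ) = i2))
    (x : Basis κ m c w) (e : E) (a : ℂ) :
    conjBy (cnotOp r i r2 i2) (Matrix.single (x, e) (x, e) a) =
      Matrix.single (cnotPerm i i2 x, e) (cnotPerm i i2 x, e) a := by
  have hx : ∀ y, x = cnotPerm i i2 y ↔ cnotPerm i i2 x = y := fun y =>
    ⟨fun e => by rw [e, cnotPerm_involutive i i2 h], fun e => by
      rw [← e, cnotPerm_involutive i i2 h]⟩
  ext p q
  rw [conjBy_cnotOp_apply i i2 h]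
  simp [Matrix.single_apply, Prod.ext_iff, hx]

/-- The label after the first `s` bits of the key are copied. -/
def copied (s : ℕ) : Basis n 0 n w :=
  mkBasis k zeros zeros (fun i => if (i : ℕ) < s then k i else false) zeros

lemma foldl_copy (a : ℂ) (s : ℕ) (hs : s ≤ n) :
    ((List.range s).map fun i => (.cnot .K i .C i : Instr Empty ℕ)).foldl
      (fun ρ g => applyGate g ρ)
      (Matrix.single (copied k 0, ()) (copied k 0, ()) a : State n 0 n w Unit) =
      Matrix.single (copied k s, ()) (copied k s, ()) a := by
  induction s with
  | zero => rfl
  | succ s ih =>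
    rw [List.range_succ, List.map_append, List.foldl_append, ih (by omega), List.map_cons,
      List.map_nil, List.foldl_cons, List.foldl_nil]
    have hsn : s < n := hs
    refine (applyGate_cnot (κ := n) (m := 0) (c := n) (w := w) (r := .K) (r2 := .C)
      (⟨s, hsn⟩ : Fin n) (⟨s, hsn⟩ : Fin n) (by simp) _).trans ?_
    rw [conjBy_cnotOp_single (r := .K) (r2 := .C) _ _ (by simp)]
    have hx : cnotPerm (r := .K) (r2 := .C) (⟨s, hsn⟩ : Fin n) (⟨s, hsn⟩ : Fin n)
        (copied k s : Basis n 0 n w) = copied k (s + 1) := by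
      rw [cnotPerm, setWire, copied, setReg_mkBasis_C, copied]
      congr 1
      funext i
      rw [mkBasis_C, mkBasis_K]
      by_cases hi : i = ⟨s, hsn⟩
      · subst hi; simp
      · rw [Function.update_of_ne hi]
        have : (i : ℕ) ≠ s := fun h => hi (Fin.ext h)
        refine if_congr ?_ rfl rfl
        omega
    rw [hx]

/-- The trivial plaintext register contributes only a scalar, so the copying circuit runs on a
single basis label. -/
lemma loadState_M_zero (X : Op (Bits 0)) :
    (loadState (c := n) w k .M X : State n 0 n w Unit) =
      Matrix.single (copied k 0, ()) (copied k 0, ()) (X zeros zeros) := by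
  have hb : ∀ μ : Bits 0, setReg (setReg (fun _ => zeros) .K k : Basis n 0 n w) .M μ =
      copied k 0 := by
    intro μ
    funext r
    cases r
    case M => exact Subsingleton.elim (α := Bits 0) _ _
    case C => funext i; rfl
    all_goals rfl
  ext ⟨p, u⟩ ⟨q, v⟩
  simp only [loadState, Matrix.of_apply, Matrix.single_apply, Prod.mk.injEq, and_true]
  rw [hb, hb]
  refine if_congr (and_congr eq_comm eq_comm) ?_ rfl
  exact congrArg₂ X (Subsingleton.elim (α := Bits 0) _ _) (Subsingleton.elim (α := Bits 0) _ _)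

lemma reduceC_single {κ m c : ℕ} {E : Type} [Fintype E] [DecidableEq E] (x : Basis κ m c w)
    (e : E) (a : ℂ) :
    reduceC (Matrix.single (x, e) (x, e) a) = Matrix.single (x .C, e) (x .C, e) a := by
  ext p q
  simp only [reduceC, Matrix.of_apply]
  rw [Finset.sum_eq_single x]
  · by_cases hp : x .C = p.1
    · have hq : x = setReg x .C q.1 ↔ x .C = q.1 :=
        ⟨fun h => (congrFun h .C).trans (setReg_same _ _ _), fun h => by
          rw [← h, setReg, Function.update_eq_self]⟩
      rw [hp] at hq
      simp [Matrix.single_apply, Prod.ext_iff, hp, hq]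
    · simp [Prod.ext_iff, hp]
  · intro y _ hy
    simp [hy.symm]
  · simp

lemma computesEnc_copy (l : List (Instr Empty ℕ))
    (hl : l = (List.range n).map fun i => .cnot .K i .C i) :
    ComputesEnc l k (prepare k : SuperOp (Bits 0) (Bits n)) := by
  intro X
  -- The list is kept abstract until here so that its width need not be computed.
  generalize width l = w
  subst hl
  have hC : (copied k n : Basis n 0 n w) .C = k := by
    funext i; simp [copied, mkBasis_C]
  rw [loadState_M_zero, foldl_copy k _ n le_rfl]
  ext ⟨p, u⟩ ⟨q, v⟩
  rw [reduceC_single, hC]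
  simp only [prepare, Matrix.trace, sum_bits_zero _ zeros, Matrix.single_apply, Matrix.of_apply,
    Matrix.smul_apply, smul_eq_mul, mul_ite, mul_one, mul_zero, Prod.mk.injEq, and_true,
    Matrix.diag_apply]

/-- The untouched flag `0` together with the trivial plaintext register already encodes the only
plaintext. -/
lemma computesDec_nil :
    ComputesDec [] k (prepare (some zeros) : SuperOp (Bits n) (Option (Bits 0))) := by
  intro Y
  generalize width ([] : List (Instr Empty ℕ)) = w
  ext ⟨μ, f⟩ ⟨ν, g⟩
  rw [List.foldl_nil, reduceMF_apply]
  change _ = flagged (prepare (some zeros) Y) (μ, f) (ν, g)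
  rw [Subsingleton.elim μ zeros, Subsingleton.elim ν zeros]
  have hl : ∀ k' γ ω, (loadState w k .C Y : State n 0 n w Unit) (mkBasis k' zeros f γ ω, ())
      (mkBasis k' zeros g γ ω, ()) =
        if k' = k then if ω = zeros then if f = zeros ∧ g = zeros then Y γ γ else 0 else 0
        else 0 := by
    intro k' γ ω
    have hb : ∀ f' : Bits 1, mkBasis k' zeros f' γ ω =
        setReg (setReg (fun _ => zeros) .K k : Basis n 0 n w) .C γ ↔
          k' = k ∧ ω = zeros ∧ f' = zeros := by
      intro f'
      constructor
      · intro h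
        exact ⟨congrFun h .K, congrFun h .W, congrFun h .F⟩
      · rintro ⟨rfl, rfl, rfl⟩
        funext r; cases r <;> rfl
    simp only [loadState, Matrix.of_apply, mkBasis_C, hb]
    by_cases h1 : k' = k <;> by_cases h2 : ω = zeros <;> simp [h1, h2]
  simp only [hl]
  have hs : (∑ k', ∑ γ, ∑ ω : Bits (w + 1), if k' = k then if ω = zeros then
      if f = zeros ∧ g = zeros then Y γ γ else 0 else 0 else 0) =
        if f = zeros ∧ g = zeros then Y.trace else 0 := by
    rw [Finset.sum_eq_single k (by intro b _ hb; simp [hb]) (by simp)]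
    by_cases h : f = zeros ∧ g = zeros <;> simp [h, Matrix.trace]
  refine hs.trans ?_
  have hz : (zeros : Bits 1) = fun _ => false := rfl
  have hn : (fun _ : Fin 1 => true) ≠ fun _ => false := fun h => by simpa using congrFun h 0
  obtain hf | hf : f = (fun _ => false) ∨ f = fun _ => true := by
    rw [bits_one_eq f]; cases f 0 <;> simp
  · obtain hg | hg : g = (fun _ => false) ∨ g = fun _ => true := by
      rw [bits_one_eq g]; cases g 0 <;> simp
    · simp [hf, hg, hz, flagged, unflag_false, prepare]
    · simp [hf, hg, hz, hn, flagged, unflag_false, unflag_true, prepare]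
  · cases hu : unflag (zeros : Bits 0) g <;> simp [hf, hz, hn, flagged, unflag_true, prepare, hu]

end circuits

/-- Only the number of instructions counts; the choice of gate is arbitrary. -/
lemma polyTimeLength_id : PolyTimeLength fun n => n :=
  ⟨.emitLoop (.hadamard .W 1), fun n => by rw [QPT.circuit_emitLoop]; simp⟩

lemma polyTimeLength_zero : PolyTimeLength fun _ => 0 :=
  ⟨.write [], fun n => by rw [QPT.circuit_write]; rfl⟩

lemma valid_keyCharacterization : keyCharacterization.Valid :=
  fun _ k => characterizes_keyDecomp k

lemma isSKQES_keyScheme : IsSKQES keyScheme where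
  keyLen_poly := polyTimeLength_id
  ptLen_poly := polyTimeLength_zero
  ctLen_poly := polyTimeLength_id
  enc_channel := fun _ k => isChannel_prepare k
  dec_channel := fun _ _ => isChannel_prepare _
  enc_qpt := ⟨.emitLoop (.cnot .K 1 .C 1), fun n k =>
    computesEnc_copy k _ (QPT.circuit_emitLoop _ n)⟩
  dec_qpt := ⟨.write [], fun n k => by
    rw [QPT.circuit_write]; exact computesDec_nil k⟩
  correct := valid_keyCharacterization.correct

end QEnc

end

theorem mainTheorem12 :
    (∀ (S : QEnc.Scheme) (T : QEnc.Characterization S), QEnc.IsSKQES S → T.Valid →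
      QEnc.QINDCCA2 S T →
        QEnc.IsSKQES S.neverReject ∧ T.neverReject.Valid ∧
        QEnc.QINDCCA2 S.neverReject T.neverReject ∧
        ∀ T₂ : QEnc.Characterization S.neverReject, T₂.Valid →
          ¬ QEnc.QUF S.neverReject T₂ ∧ ¬ QEnc.QAE S.neverReject T₂) ∧
    (∃ (S : QEnc.Scheme) (T : QEnc.Characterization S), QEnc.IsSKQES S ∧ T.Valid ∧
      QEnc.QINDCCA2 S T ∧
        ∀ T₂ : QEnc.Characterization S, T₂.Valid → ¬ QEnc.QUF S T₂ ∧ ¬ QEnc.QAE S T₂) := by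
  refine ⟨fun S T hS hT h => ?_, QEnc.keyScheme, QEnc.keyCharacterization,
    QEnc.isSKQES_keyScheme, QEnc.valid_keyCharacterization, ?_, fun T₂ _ => ?_⟩
  · have hS' := hS.neverReject hT
    -- The entries of `rejectToZero` at `none` vanish by definition.
    have hN : ∀ n k Y, S.neverReject.Dec n k Y none none = 0 := fun _ _ _ => rfl
    exact ⟨hS', hT.neverReject, h.neverReject, fun T₂ _ =>
      ⟨QEnc.not_QUF_of_never_rejects hS'.dec_channel hN T₂,
        QEnc.not_QAE_of_never_rejects hS'.dec_channel hN T₂⟩⟩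
  · exact QEnc.QINDCCA2_of_ptLen_eq_zero QEnc.isSKQES_keyScheme.enc_channel
      QEnc.isSKQES_keyScheme.dec_channel QEnc.valid_keyCharacterization fun _ => rfl
  · have hN : ∀ n k Y, QEnc.keyScheme.Dec n k Y none none = 0 := fun _ _ _ => by
      simp [QEnc.keyScheme, QEnc.prepare]
    exact ⟨QEnc.not_QUF_of_never_rejects QEnc.isSKQES_keyScheme.dec_channel hN T₂,
      QEnc.not_QAE_of_never_rejects QEnc.isSKQES_keyScheme.dec_channel hN T₂⟩
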